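/- Let $\mathcal M$ be the set of Borel measures $\eta$ on $\mathbb R$ with $\eta(\mathbb R)<\infty$ and $\int|x|\,\eta(dx)<\infty$. For $\eta\in\mathcal M$ put $\overline\eta=\int x\,\eta(dx)$, $P_\eta(k)=\int (k-x)^+\,\eta(dx)$ and $C_\eta(k)=\int (x-k)^+\,\eta(dx)$. For $\eta,\chi\in\mathcal M$ write $\eta\le_c\chi$ if $\int f\,d\eta\le\int f\,d\chi$ for all convex $f:\mathbb R\to\mathbb R$ (with integrals in $(-\infty,\infty]$). For $f:\mathbb R\to\mathbb R$ let $f^c$ be its largest convex minorant. Let $\mu,\nu\in\mathcal M$ with $\mu(\mathbb R)\le\nu(\mathbb R)$. Put $$\mathcal T_{\mu,\nu}=\{\theta\in\mathcal M:\theta(\mathbb R)=\mu(\mathbb R),\ \theta\le\nu\},\qquad p_{\mu,\nu}=\sup_{k\in\mathbb R}\{P_\mu(k)-P_\nu(k)\},\qquad c_{\mu,\nu}=\sup_{k\in\mathbb R}\{C_\mu(k)-C_\nu(k)\},$$ and, for $\theta\in\mathcal T_{\mu,\nu}$, $$V(\mu,\theta)=\inf_{\pi\in\Pi(\mu,\theta)}\int_{\mathbb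 R}\Big|x-\int_{\mathbb R}y\,\pi_x(dy)\Big|\,\mu(dx),$$ where $\Pi(\mu,\theta)$ is the set of measures $\pi$ on $\mathbb R^2$ with marginals $\mu$ and $\theta$, and $\pi(dx,dy)=\mu(dx)\,\pi_x(dy)$ is the disintegration of $\pi$ into probability measures $\pi_x$. The generalized shadow measure $S^\nu(\mu)$ is well defined: there is exactly one measure $S^\nu(\mu)\in\mathcal T_{\mu,\nu}$ with $$P_{S^\nu(\mu)}(k)=P_\nu(k)-(P_\nu-P_\mu)^c(k)-p_{\mu,\nu}\qquad\text{for all }k\in\mathbb R;$$ it is the second distributional derivative of $k\mapsto P_\nu(k)-(P_\nu-P_\mu)^c(k)$, and $\overline{S^\nu(\mu)}=\overline\mu+p_{\mu,\nu}-c_{\mu,\nu}$. Moreover, $S^\nu(\mu)$ is the unique element of $\mathcal T_{\mu,\nu}$ such that 1. $S^\nu(\mu)\in\arg\min_{\theta\in\mathcal T_{\mu,\nu}}V(\mu,\theta)$; 2. $S^\nu(\mu)\le_c\theta^*$ for all $\theta^*\in\arg\min_{\theta\in\mathcal T_{\mu,\nu}}V(\mu,\theta)$. -/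

import Mathlib

open MeasureTheory ProbabilityTheory
open scoped ENNReal ContDiff

namespace ShadowWOT

/-- Borel measures with finite total mass and finite first moment (used for `ℝ` and `ℝ × ℝ`). -/
def FinMoment (E : Type*) [NormedAddCommGroup E] [MeasurableSpace E] : Set (Measure E) :=
  {η | IsFiniteMeasure η ∧ Integrable (fun x : E => x) η}

/-- The first moment `∫ x η(dx)` (not normalised by the mass). -/
noncomputable def mean (η : Measure ℝ) : ℝ := ∫ x, x ∂η

/-- The modified potential `P_η(k) = ∫ (k - x)⁺ η(dx)`. -/
noncomputable def putPot (η : Measure ℝ) (k : ℝ) : ℝ := ∫ x, max (k - x) 0 ∂η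

/-- The modified potential `C_η(k) = ∫ (x - k)⁺ η(dx)`. -/
noncomputable def callPot (η : Measure ℝ) (k : ℝ) : ℝ := ∫ x, max (x - k) 0 ∂η

/-- `p_{μ,ν} = sup_k (P_μ(k) - P_ν(k))`. -/
noncomputable def putGap (μ ν : Measure ℝ) : ℝ := ⨆ k : ℝ, (putPot μ k - putPot ν k)

/-- `c_{μ,ν} = sup_k (C_μ(k) - C_ν(k))`. -/
noncomputable def callGap (μ ν : Measure ℝ) : ℝ := ⨆ k : ℝ, (callPot μ k - callPot ν k)

/-- The largest convex minorant `f^c` of a function `f : ℝ → ℝ` that has a convex minorant: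
the pointwise supremum of all convex functions below `f`. -/
noncomputable def convMinorant (f : ℝ → ℝ) (k : ℝ) : ℝ :=
  ⨆ g : {g : ℝ → ℝ // ConvexOn ℝ Set.univ g ∧ ∀ x, g x ≤ f x}, g.1 k

/-- The measure `m` is the second derivative of `f` in the sense of distributions. -/
def IsSecondDistribDeriv (f : ℝ → ℝ) (m : Measure ℝ) : Prop :=
  LocallyIntegrable f volume ∧ IsLocallyFiniteMeasure m ∧
    ∀ φ : ℝ → ℝ, ContDiff ℝ ∞ φ → HasCompactSupport φ →
      ∫ x, f x * iteratedDeriv 2 φ x = ∫ x, φ x ∂m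

/-- The set `T_{μ,ν}` of target measures for `μ` in `ν`. -/
def targets (μ ν : Measure ℝ) : Set (Measure ℝ) :=
  {θ | θ ∈ FinMoment ℝ ∧ θ Set.univ = μ Set.univ ∧ θ ≤ ν}

/-- The function `P_ν - (P_ν - P_μ)^c`. -/
noncomputable def shadowFun (μ ν : Measure ℝ) (k : ℝ) : ℝ :=
  putPot ν k - convMinorant (fun x => putPot ν x - putPot μ x) k

open Classical in
/-- The generalized shadow measure `S^ν(μ)`: the measure in `T_{μ,ν}` with potential
`P_ν - (P_ν - P_μ)^c - p_{μ,ν}` (and `0` if there is none). -/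
noncomputable def shadow (μ ν : Measure ℝ) : Measure ℝ :=
  if h : ∃ S ∈ targets μ ν, ∀ k, putPot S k = shadowFun μ ν k - putGap μ ν then h.choose else 0

/-- The couplings of `η` and `χ`. -/
def couplings (η χ : Measure ℝ) : Set (Measure (ℝ × ℝ)) :=
  {π | π ∈ FinMoment (ℝ × ℝ) ∧ π.map Prod.fst = η ∧ π.map Prod.snd = χ}

/-- The weak `L¹` transport cost
`V(η,χ) = inf_{π ∈ Π(η,χ)} ∫ |x - ∫ y π_x(dy)| η(dx)`. The infimum runs over all couplings `π` and
all disintegrations `π(dx,dy) = η(dx) π_x(dy)` into Markov kernels (they exist and agree up to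
`η`-null sets, so that the cost depends on `π` alone). -/
noncomputable def weakCost (η χ : Measure ℝ) : ℝ≥0∞ :=
  ⨅ (π : Measure (ℝ × ℝ)) (_ : π ∈ couplings η χ)
    (κ : Kernel ℝ ℝ) (_ : IsMarkovKernel κ) (_ : π = η ⊗ₘ κ),
    ∫⁻ x, ENNReal.ofReal |x - ∫ y, y ∂(κ x)| ∂η

/-- The minimizers of `θ ↦ V(μ,θ)` over `T_{μ,ν}`. -/
def minimizers (μ ν : Measure ℝ) : Set (Measure ℝ) :=
  {θ | θ ∈ targets μ ν ∧ ∀ θ' ∈ targets μ ν, weakCost μ θ ≤ weakCost μ θ'}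

/-- Convex order: `∫ f dη ≤ ∫ f dχ` for every convex `f : ℝ → ℝ`. For measures with finite mass and
first moment the negative part of a convex `f` is integrable, so both integrals are defined in
`(-∞, ∞]`. If `f` is not `χ`-integrable, then the right side is `∞` and nothing is required;
otherwise the left side has to be finite as well. -/
def ConvexLE (η χ : Measure ℝ) : Prop :=
  ∀ f : ℝ → ℝ, ConvexOn ℝ Set.univ f → Integrable f χ →
    Integrable f η ∧ ∫ x, f x ∂η ≤ ∫ x, f x ∂χ

end ShadowWOT

open ShadowWOT

namespace ShadowWOT
open Filter Topology Set

/-! ### Convex functions and convex minorants on the line -/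

/-! Write `p`, `c` for the two gaps of μ and ν, and `D` for the largest convex minorant of `P_ν -
P_μ`.

Existence of the shadow `S` rests on convexity of `P_ν - D` (`convexOn_sub_convMinorant`). Then
`P_ν` is a sum of two convex functions, and their second derivatives split ν into two measures
(`exists_le_putPot_eq`). The limits of the minorants at `±∞` give the constant `p`, the mass and the
mean.

Lower bound for the cost: let `b` be the barycentre map of a coupling of μ and θ, with `A = ∫ (b -
x)⁺ dμ` and `B = ∫ (x - b)⁺ dμ`. The cost is `A + B`, and Jensen gives `P_μ - P_θ ≤ A` and `C_μ -
C_θ ≤ B`. As `θ ≤ ν`, this yields `A ≥ p` and `B ≥ c` (`exists_bounds_of_weakCost_lt`,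
`le_weakCost`).

Upper bound: for equal masses, `V(μ,θ) ≤ p_{μ,θ} + c_{μ,θ}` (`weakCost_le`). Cut μ into small pieces
and embed each by its own shadow into what the earlier pieces left of θ. Each embedding lowers both
gaps by at least the amounts it uses (`putGap_le_sub`, `callGap_le_sub`), so the displacements of
the barycentres telescope.

The shadow satisfies `P_μ - P_S ≤ p` and has mean `mean μ + p - c`, so it attains `p + c`. For
another minimizer θ, the bounds on `A` and `B` force `P_μ - p ≤ P_θ` and the same mean. So `P_{ν-θ}
- p` is a convex minorant of `P_ν - P_μ` and lies below `D`, which says `P_S ≤ P_θ`. The gaps of `S`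
and θ are then nonpositive, hence `V(S,θ) = 0`, and this gives convex order
(`convexLE_of_weakCost_eq_zero`). Uniqueness holds because potentials are monotone in convex order
and determine the measure. -/

theorem chord_le {D : ℝ → ℝ} (hD : ConvexOn ℝ univ D) {x y z : ℝ} (hxy : x ≤ y) (hyz : y ≤ z) :
    (z - x) * D y ≤ (z - y) * D x + (y - x) * D z := by
  rcases hxy.eq_or_lt with rfl | hxy
  · linarith
  rcases hyz.eq_or_lt with rfl | hyz
  · linarith
  have h := hD.slope_mono_adjacent (mem_univ x) (mem_univ z) hxy hyz
  rw [div_le_div_iff₀ (by linarith) (by linarith)] at h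
  nlinarith

theorem convexOn_of_chord {D : ℝ → ℝ}
    (h : ∀ x y z, x < y → y < z → (z - x) * D y ≤ (z - y) * D x + (y - x) * D z) :
    ConvexOn ℝ univ D := by
  refine LinearOrder.convexOn_of_lt convex_univ fun x _ z _ hxz a b ha hb hab => ?_
  have hz : 0 < z - x := by linarith
  obtain rfl : a = 1 - b := by linarith
  have := h x ((1 - b) * x + b * z) z (by nlinarith) (by nlinarith)
  simp only [smul_eq_mul]
  have e1 : z - ((1 - b) * x + b * z) = (1 - b) * (z - x) := by ring
  have e2 : (1 - b) * x + b * z - x = b * (z - x) := by ring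
  rw [e1, e2] at this
  refine le_of_mul_le_mul_left ?_ hz
  linarith

theorem _root_.ConvexOn.continuous_real {f : ℝ → ℝ} (hf : ConvexOn ℝ univ f) : Continuous f :=
  continuousOn_univ.1 (hf.continuousOn isOpen_univ)

theorem convexOn_affine (a b : ℝ) : ConvexOn ℝ univ fun x : ℝ => a * x + b :=
  convexOn_of_chord fun x y z _ _ => le_of_eq (by ring)

/-- `f` has a convex minorant. -/
def HasConvMinorant (f : ℝ → ℝ) : Prop :=
  ∃ g : ℝ → ℝ, ConvexOn ℝ univ g ∧ ∀ x, g x ≤ f x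

theorem bddAbove_convMinorant (f : ℝ → ℝ) (k : ℝ) :
    BddAbove (range fun g : {g : ℝ → ℝ // ConvexOn ℝ univ g ∧ ∀ x, g x ≤ f x} => g.1 k) :=
  ⟨f k, by rintro _ ⟨g, rfl⟩; exact g.2.2 k⟩

theorem le_convMinorant {f g : ℝ → ℝ} (hg : ConvexOn ℝ univ g) (h : ∀ x, g x ≤ f x) (k : ℝ) :
    g k ≤ convMinorant f k :=
  le_ciSup (bddAbove_convMinorant f k)
    (⟨g, hg, h⟩ : {g : ℝ → ℝ // ConvexOn ℝ univ g ∧ ∀ x, g x ≤ f x})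

theorem HasConvMinorant.convMinorant_le {f : ℝ → ℝ} (hf : HasConvMinorant f) (k : ℝ) :
    convMinorant f k ≤ f k := by
  obtain ⟨g, hg⟩ := hf
  have : Nonempty {g : ℝ → ℝ // ConvexOn ℝ univ g ∧ ∀ x, g x ≤ f x} := ⟨⟨g, hg⟩⟩
  exact ciSup_le fun g => g.2.2 k

theorem HasConvMinorant.convexOn {f : ℝ → ℝ} (hf : HasConvMinorant f) :
    ConvexOn ℝ univ (convMinorant f) := by
  obtain ⟨g, hg⟩ := hf
  have : Nonempty {g : ℝ → ℝ // ConvexOn ℝ univ g ∧ ∀ x, g x ≤ f x} := ⟨⟨g, hg⟩⟩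
  refine ⟨convex_univ, fun x _ y _ a b ha hb hab => ciSup_le fun g => ?_⟩
  refine (g.2.1.2 (mem_univ x) (mem_univ y) ha hb hab).trans ?_
  have h1 := le_convMinorant g.2.1 g.2.2 x
  have h2 := le_convMinorant g.2.1 g.2.2 y
  simp only [smul_eq_mul]
  gcongr

theorem HasConvMinorant.add_affine {f : ℝ → ℝ} (hf : HasConvMinorant f) (a b : ℝ) :
    HasConvMinorant fun x => f x + (a * x + b) := by
  obtain ⟨g, hg, h⟩ := hf
  exact ⟨fun x => g x + (a * x + b), hg.add (convexOn_affine a b), fun x => by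
    have := h x; simp only; linarith⟩

theorem HasConvMinorant.convMinorant_add_affine {f : ℝ → ℝ} (hf : HasConvMinorant f)
    (a b k : ℝ) :
    convMinorant (fun x => f x + (a * x + b)) k = convMinorant f k + (a * k + b) := by
  apply le_antisymm
  · have h1 := (hf.add_affine a b).convexOn.add (convexOn_affine (-a) (-b))
    have h2 := le_convMinorant (f := f) h1 (fun x => by
      have := (hf.add_affine a b).convMinorant_le x
      simp only [Pi.add_apply]; linarith) k
    simp only [Pi.add_apply] at h2
    linarith
  · exact le_convMinorant (f := fun x => f x + (a * x + b))
      (g := fun x => convMinorant f x + (a * x + b)) (hf.convexOn.add (convexOn_affine a b))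
      (fun x => by have := hf.convMinorant_le x; linarith) k

theorem convexOn_comp_neg {g : ℝ → ℝ} (hg : ConvexOn ℝ univ g) :
    ConvexOn ℝ univ fun x => g (-x) :=
  convexOn_of_chord fun x y z hxy hyz => by
    have := chord_le hg (neg_le_neg hyz.le) (neg_le_neg hxy.le)
    linarith

theorem HasConvMinorant.comp_neg {f : ℝ → ℝ} (hf : HasConvMinorant f) :
    HasConvMinorant fun x => f (-x) := by
  obtain ⟨g, hg, h⟩ := hf
  exact ⟨fun x => g (-x), convexOn_comp_neg hg, fun x => h _⟩

theorem HasConvMinorant.convMinorant_comp_neg {f : ℝ → ℝ} (hf : HasConvMinorant f) (k : ℝ) :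
    convMinorant (fun x => f (-x)) k = convMinorant f (-k) := by
  apply le_antisymm
  · have := le_convMinorant (f := f) (convexOn_comp_neg hf.comp_neg.convexOn) (fun x => by
      simpa using hf.comp_neg.convMinorant_le (-x)) (-k)
    simpa using this
  · exact le_convMinorant (f := fun x => f (-x)) (convexOn_comp_neg hf.convexOn)
      (fun x => hf.convMinorant_le _) k

/-- Away from the contact set the largest convex minorant is locally affine. -/
theorem HasConvMinorant.midpoint_le {f : ℝ → ℝ} (hf : HasConvMinorant f) {s : ℝ}
    (hc : ContinuousAt f s) (hs : convMinorant f s < f s) :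
    ∃ δ₀ > 0, ∀ δ > 0, δ ≤ δ₀ →
      convMinorant f (s - δ) + convMinorant f (s + δ) ≤ 2 * convMinorant f s := by
  set D := convMinorant f with hDdef
  have hD : ConvexOn ℝ univ D := hf.convexOn
  -- A level `c` separates `D` from `f` near `s`. The chord `l` of `D` over a short interval stays
  -- below `c` inside it and below `D` outside, so `D ⊔ l` is a convex minorant and `l s ≤ D s`.
  obtain ⟨c, hc1, hc2⟩ := exists_between hs
  have hev : ∀ᶠ x in 𝓝 s, D x < c ∧ c < f x :=
    (hD.continuous_real.continuousAt.eventually_lt_const hc1).and (hc.eventually_const_lt hc2)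
  obtain ⟨ε, hε, hball⟩ := Metric.eventually_nhds_iff.1 hev
  refine ⟨ε / 2, by positivity, fun δ hδ hδε => ?_⟩
  have hloc : ∀ x, s - δ ≤ x → x ≤ s + δ → D x < c ∧ c < f x := fun x h1 h2 =>
    hball (by rw [Real.dist_eq, abs_lt]; constructor <;> linarith)
  set β := (D (s + δ) - D (s - δ)) / (2 * δ) with hβ
  have hβ' : β * (2 * δ) = D (s + δ) - D (s - δ) := by rw [hβ]; field_simp
  set l : ℝ → ℝ := fun x => β * x + (D (s - δ) - β * (s - δ)) with hl
  have hl1 : l (s - δ) = D (s - δ) := by simp [hl]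
  have hl2 : l (s + δ) = D (s + δ) := by simp only [hl]; linarith
  have hmax := le_convMinorant (f := f) (hD.sup (convexOn_affine β (D (s - δ) - β * (s - δ))))
    (fun x => ?_) s
  · have h1 := (le_sup_right : _ ≤ D s ⊔ l s).trans hmax
    rw [← hDdef] at h1
    simp only [hl] at h1
    linarith
  · refine sup_le (hf.convMinorant_le x) ?_
    change l x ≤ f x
    have hlin : 2 * δ * l x = (s + δ - x) * D (s - δ) + (x - (s - δ)) * D (s + δ) := by
      rw [← hl1, ← hl2]; simp only [hl]; ring
    by_cases h1 : x < s - δ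
    · have := chord_le hD h1.le (by linarith : s - δ ≤ s + δ)
      refine le_trans ?_ (hf.convMinorant_le x)
      refine le_of_mul_le_mul_left (a := 2 * δ) ?_ (by positivity)
      rw [hlin]; linarith
    by_cases h2 : s + δ < x
    · have := chord_le hD (by linarith : s - δ ≤ s + δ) h2.le
      refine le_trans ?_ (hf.convMinorant_le x)
      refine le_of_mul_le_mul_left (a := 2 * δ) ?_ (by positivity)
      rw [hlin]; linarith
    push Not at h1 h2
    refine le_trans ?_ (hloc x h1 h2).2.le
    refine le_of_mul_le_mul_left (a := 2 * δ) ?_ (by positivity)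
    rw [hlin]
    have a1 := (hloc (s - δ) (by linarith) (by linarith)).1
    have a2 := (hloc (s + δ) (by linarith) (by linarith)).1
    nlinarith

/-- If `g` and `h` are convex, then so is `g - (g - h)ᶜ`. -/
theorem convexOn_sub_convMinorant {g h : ℝ → ℝ} (hg : ConvexOn ℝ univ g)
    (hh : ConvexOn ℝ univ h) (hf : HasConvMinorant fun x => g x - h x) :
    ConvexOn ℝ univ fun x => g x - convMinorant (fun x => g x - h x) x := by
  set D := convMinorant (fun x => g x - h x) with hDdef
  have hD : ConvexOn ℝ univ D := hf.convexOn
  have hle : ∀ x, h x ≤ g x - D x := fun x => by have := hf.convMinorant_le x; linarith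
  refine convexOn_of_chord fun a t b hat htb => ?_
  by_contra hcon
  push Not at hcon
  have hab : 0 < b - a := by linarith
  set β := ((g b - D b) - (g a - D a)) / (b - a) with hβ
  have hβ' : β * (b - a) = (g b - D b) - (g a - D a) := by rw [hβ]; field_simp
  set l : ℝ → ℝ := fun x => β * x + ((g a - D a) - β * a) with hl
  set G : ℝ → ℝ := fun x => g x - D x - l x with hG
  have hGa : G a = 0 := by simp [hG, hl]
  have hGb : G b = 0 := by simp only [hG, hl]; linarith
  have hGt : 0 < G t := by
    have e : (b - a) * l t = (b - t) * (g a - D a) + (t - a) * (g b - D b) := by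
      simp only [hl]; linear_combination (t - a) * hβ'
    have : 0 < (b - a) * G t := by
      have : (b - a) * G t = (b - a) * (g t - D t) - (b - a) * l t := by simp only [hG]; ring
      rw [this, e]; linarith
    exact (pos_iff_pos_of_mul_pos this).1 hab
  have hGc : Continuous G := by
    have h1 := hg.continuous_real
    have h2 := hD.continuous_real
    simp only [hG, hl]; fun_prop
  obtain ⟨s₀, hs₀, hmax₀⟩ := isCompact_Icc.exists_isMaxOn (s := Icc a b)
    ⟨t, hat.le, htb.le⟩ hGc.continuousOn
  have hcomp : IsCompact (Icc a b ∩ G ⁻¹' {G s₀}) :=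
    isCompact_Icc.inter_right (isClosed_singleton.preimage hGc)
  -- The leftmost maximizer of `G` makes `G (s - δ) < G s` strict, which contradicts midpoint
  -- convexity of `G` at `s` when `s` is off the contact set.
  obtain ⟨s, ⟨hsI, hsG⟩, hsleast⟩ := hcomp.exists_isLeast ⟨s₀, hs₀, rfl⟩
  have hsG : G s = G s₀ := hsG
  have hM : 0 < G s := hGt.trans_le (hsG ▸ hmax₀ ⟨hat.le, htb.le⟩)
  have hmax : ∀ x ∈ Icc a b, G x ≤ G s := fun x hx => hsG ▸ hmax₀ hx
  have has : a < s := lt_of_le_of_ne hsI.1 fun e => by rw [← e, hGa] at hM; exact hM.false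
  have hsb : s < b := lt_of_le_of_ne hsI.2 fun e => by rw [e, hGb] at hM; exact hM.false
  have hlt : ∀ x, a ≤ x → x < s → G x < G s := fun x hax hxs =>
    lt_of_le_of_ne (hmax x ⟨hax, hxs.le.trans hsI.2⟩) fun e =>
      (hsleast ⟨⟨hax, hxs.le.trans hsI.2⟩, e.trans hsG⟩).not_gt hxs
  by_cases hcontact : D s < g s - h s
  · obtain ⟨δ₀, hδ₀, hmid⟩ := hf.midpoint_le
      (hg.continuous_real.sub hh.continuous_real).continuousAt hcontact
    set δ := min δ₀ (min (s - a) (b - s)) with hδ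
    have hδpos : 0 < δ := lt_min hδ₀ (lt_min (by linarith) (by linarith))
    have hδ1 : δ ≤ s - a := (min_le_right _ _).trans (min_le_left _ _)
    have hδ2 : δ ≤ b - s := (min_le_right _ _).trans (min_le_right _ _)
    have h1 := hmid δ hδpos (min_le_left _ _)
    have h2 := hlt (s - δ) (by linarith) (by linarith)
    have h3 := hmax (s + δ) ⟨by linarith, by linarith⟩
    have h4 := chord_le hg (x := s - δ) (y := s) (z := s + δ) (by linarith) (by linarith)
    have h5 : 2 * g s ≤ g (s - δ) + g (s + δ) := by
      refine le_of_mul_le_mul_left (a := δ) ?_ hδpos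
      nlinarith
    rw [← hDdef] at h1
    simp only [hG, hl] at h2 h3
    linarith
  -- At a contact point `g - D` equals `h`, and `h ≤ g - D` at the endpoints; convexity of `h` then
  -- puts `g s - D s` below its chord.
  · push Not at hcontact
    have h1 := chord_le hh has.le hsb.le
    have h2 := hle a
    have h3 := hle b
    have e : (b - a) * l s = (b - s) * (g a - D a) + (s - a) * (g b - D b) := by
      simp only [hl]; linear_combination (s - a) * hβ'
    have h4 : l s < h s := by simp only [hG] at hM; linarith
    have h5 : (b - s) * h a ≤ (b - s) * (g a - D a) := by gcongr
    have h6 : (s - a) * h b ≤ (s - a) * (g b - D b) := by gcongr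
    have h7 : (b - a) * l s < (b - a) * h s := by gcongr
    linarith

/-- The right derivative of a convex function is right-continuous. -/
theorem rightDeriv_continuousWithinAt {f : ℝ → ℝ} (hf : ConvexOn ℝ univ f) (x : ℝ) :
    ContinuousWithinAt (fun x => derivWithin f (Ioi x) x) (Ici x) x := by
  have hmono : Monotone fun x => derivWithin f (Ioi x) x := by
    intro x y hxy
    exact hf.monotoneOn_rightDeriv (by simp) (by simp) hxy
  have hder : ∀ y, HasDerivWithinAt f (derivWithin f (Ioi y) y) (Ioi y) y := fun y =>
    hf.hasDerivWithinAt_rightDeriv_of_mem_interior (by simp)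
  rw [← continuousWithinAt_Ioi_iff_Ici]
  refine tendsto_order.2 ⟨fun a ha => ?_, fun a ha => ?_⟩
  · filter_upwards [self_mem_nhdsWithin] with y hy
    exact ha.trans_le (hmono (le_of_lt hy))
  -- Some secant slope from `x` to `z` is below `a`; it varies continuously in its left endpoint `y`
  -- and dominates the right derivative at `y`.
  · have hs := (hasDerivWithinAt_iff_tendsto_slope' self_notMem_Ioi).1 (hder x)
    obtain ⟨z, hz, hxz⟩ := ((hs.eventually_lt_const ha).and self_mem_nhdsWithin).exists
    have hxz : x < z := hxz
    have hc : ContinuousAt (fun y => slope f y z) x := by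
      simp only [slope_def_field]
      have := hf.continuous_real
      exact (continuousAt_const.sub this.continuousAt).div
        (continuousAt_const.sub continuousAt_id) (sub_ne_zero.2 hxz.ne')
    have h1 : ∀ᶠ y in 𝓝[>] x, slope f y z < a ∧ y < z :=
      ((hc.eventually_lt_const hz).and (eventually_lt_nhds hxz)).filter_mono nhdsWithin_le_nhds
    filter_upwards [h1] with y hy
    exact (hf.le_slope_of_hasDerivWithinAt_Ioi (mem_univ y) (mem_univ z) hy.2 (hder y)).trans_lt
      hy.1

/-- The minorant is bounded above near `-∞`, and a convex function with this property is monotone.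
Its limit is therefore its infimum, which equals that of `f`. -/
theorem tendsto_convMinorant_atBot {f : ℝ → ℝ} {p L : ℝ} (hf : Tendsto f atBot (𝓝 L))
    (hp : IsGLB (range f) p) : Tendsto (convMinorant f) atBot (𝓝 p) := by
  have hlow : ∀ x, p ≤ f x := fun x => hp.1 ⟨x, rfl⟩
  have hconst : ConvexOn ℝ univ fun _ : ℝ => p := convexOn_const _ convex_univ
  have hm : HasConvMinorant f := ⟨_, hconst, hlow⟩
  have hD := hm.convexOn
  set D := convMinorant f
  have hDp : ∀ x, p ≤ D x := le_convMinorant hconst hlow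
  obtain ⟨B, hB⟩ : ∃ B, ∀ x ≤ B, f x < L + 1 := by
    have := hf.eventually_lt_const (lt_add_one L)
    exact eventually_atBot.1 this
  have hDB : ∀ x ≤ B, D x ≤ L + 1 := fun x hx => (hm.convMinorant_le x).trans (hB x hx).le
  have hmono : Monotone D := by
    intro x y hxy
    by_contra hlt
    push Not at hlt
    have hxy' : x < y := lt_of_le_of_ne hxy fun e => by rw [e] at hlt; exact hlt.false
    have key : ∀ w < x, D x + (x - w) * ((D x - D y) / (y - x)) ≤ D w := by
      intro w hw
      have h1 := hD.slope_mono_adjacent (mem_univ w) (mem_univ y) hw hxy'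
      have h2 : -((D x - D y) / (y - x)) = (D y - D x) / (y - x) := by ring
      rw [div_le_iff₀ (by linarith), ← h2] at h1
      linarith
    set r := (D x - D y) / (y - x) with hr
    have hrpos : 0 < r := div_pos (by linarith) (by linarith)
    -- Far enough left that a descending secant extrapolates to at least `L + 2`, against the bound
    -- `L + 1`.
    set w := min (min B (x - 1)) (x - (L + 2 - D x) / r) with hw
    have hw1 : w ≤ B := (min_le_left _ _).trans (min_le_left _ _)
    have hw2 : w ≤ x - 1 := (min_le_left _ _).trans (min_le_right _ _)
    have hw3 : w ≤ x - (L + 2 - D x) / r := min_le_right _ _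
    have h1 := key w (by linarith)
    have h2 := hDB w hw1
    have h3 : (L + 2 - D x) / r ≤ x - w := by linarith
    rw [div_le_iff₀ hrpos] at h3
    linarith
  refine tendsto_order.2 ⟨fun a ha => Eventually.of_forall fun x => ha.trans_le (hDp x),
    fun a ha => ?_⟩
  obtain ⟨_, ⟨x, rfl⟩, hx⟩ := (isGLB_lt_iff hp).1 ha
  filter_upwards [eventually_le_atBot x] with y hy
  exact (hmono hy).trans_lt ((hm.convMinorant_le x).trans_lt hx)

theorem tendsto_convMinorant_atTop {f : ℝ → ℝ} {p L : ℝ} (hf : Tendsto f atTop (𝓝 L))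
    (hp : IsGLB (range f) p) : Tendsto (convMinorant f) atTop (𝓝 p) := by
  have hm : HasConvMinorant f := ⟨_, convexOn_const p convex_univ, fun x => hp.1 ⟨x, rfl⟩⟩
  have h1 := tendsto_convMinorant_atBot (f := fun x => f (-x)) (hf.comp tendsto_neg_atBot_atTop)
    (p := p) (by
      have : range (fun x => f (-x)) = range f := (Equiv.neg ℝ).surjective.range_comp f
      rwa [this])
  have h2 := h1.comp tendsto_neg_atTop_atBot
  refine h2.congr fun x => ?_
  simp [hm.convMinorant_comp_neg]

/-! ### Potentials of measures -/

section potentials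

variable {η : Measure ℝ} [IsFiniteMeasure η]

theorem integrable_put (hη : Integrable (fun x : ℝ => x) η) (k : ℝ) :
    Integrable (fun x => max (k - x) 0) η :=
  ((integrable_const k).sub hη).pos_part

theorem integrable_call (hη : Integrable (fun x : ℝ => x) η) (k : ℝ) :
    Integrable (fun x => max (x - k) 0) η :=
  (hη.sub (integrable_const k)).pos_part

/-- Put-call parity. It turns every statement about calls into one about puts plus an affine term.
-/
theorem callPot_eq (hη : Integrable (fun x : ℝ => x) η) (k : ℝ) :
    callPot η k = putPot η k + (-η.real univ * k + mean η) := by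
  have h : callPot η k - putPot η k = mean η - η.real univ * k := by
    unfold callPot putPot mean
    rw [← integral_sub (integrable_call hη k) (integrable_put hη k)]
    calc ∫ x, (max (x - k) 0 - max (k - x) 0) ∂η = ∫ x, (x - k) ∂η :=
          integral_congr_ae (Eventually.of_forall fun x => by
            rcases le_total x k with h | h
            · simp only [max_eq_right (sub_nonpos.2 h), max_eq_left (sub_nonneg.2 h)]; ring
            · simp only [max_eq_right (sub_nonpos.2 h), max_eq_left (sub_nonneg.2 h)]; ring)
      _ = _ := by rw [integral_sub hη (integrable_const k)]; simp
  linarith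

theorem convexOn_put (x : ℝ) : ConvexOn ℝ univ fun k : ℝ => max (k - x) 0 :=
  (convexOn_of_chord fun a b c _ _ => le_of_eq (by ring) : ConvexOn ℝ univ fun k : ℝ => k - x).sup
    (convexOn_const 0 convex_univ)

theorem convexOn_put' (k : ℝ) : ConvexOn ℝ univ fun x : ℝ => max (k - x) 0 :=
  (convexOn_of_chord fun a b c _ _ => le_of_eq (by ring) : ConvexOn ℝ univ fun x : ℝ => k - x).sup
    (convexOn_const 0 convex_univ)

theorem convexOn_putPot (hη : Integrable (fun x : ℝ => x) η) : ConvexOn ℝ univ (putPot η) := by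
  refine convexOn_of_chord fun a b c hab hbc => ?_
  unfold putPot
  rw [← integral_const_mul, ← integral_const_mul, ← integral_const_mul,
    ← integral_add ((integrable_put hη a).const_mul _) ((integrable_put hη c).const_mul _)]
  exact integral_mono ((integrable_put hη b).const_mul _)
    (((integrable_put hη a).const_mul _).add ((integrable_put hη c).const_mul _))
    fun x => chord_le (convexOn_put x) hab.le hbc.le

theorem continuous_putPot (hη : Integrable (fun x : ℝ => x) η) : Continuous (putPot η) :=
  (convexOn_putPot hη).continuous_real

/-- The difference quotients of the payoffs are bounded by `1`. From the right they converge to the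
indicator of the closed half-line, so dominated convergence gives the distribution function. -/
theorem hasDerivWithinAt_putPot (hη : Integrable (fun x : ℝ => x) η) (k : ℝ) :
    HasDerivWithinAt (putPot η) (η.real (Iic k)) (Ioi k) k := by
  rw [hasDerivWithinAt_iff_tendsto_slope' self_notMem_Ioi]
  have h1 : ∀ y, slope (putPot η) k y =
      ∫ x, (max (y - x) 0 - max (k - x) 0) / (y - k) ∂η := fun y => by
    rw [slope_def_field, integral_div, integral_sub (integrable_put hη y) (integrable_put hη k)]
    rfl
  rw [← integral_indicator_one measurableSet_Iic]
  rw [show slope (putPot η) k = fun y => ∫ x, (max (y - x) 0 - max (k - x) 0) / (y - k) ∂η from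
    funext h1]
  refine tendsto_integral_filter_of_dominated_convergence (fun _ => 1) ?_ ?_
    (integrable_const _) ?_
  · exact Eventually.of_forall fun y => by fun_prop
  · filter_upwards [self_mem_nhdsWithin] with y hy
    have hy : 0 < y - k := sub_pos.2 hy
    refine Eventually.of_forall fun x => ?_
    rw [Real.norm_eq_abs, abs_div, abs_of_pos hy, div_le_one hy]
    refine (abs_max_sub_max_le_abs _ _ _).trans ?_
    rw [show y - x - (k - x) = y - k by ring, abs_of_pos hy]
  · refine Eventually.of_forall fun x => ?_
    by_cases hx : x ≤ k
    · have : (Iic k).indicator (1 : ℝ → ℝ) x = 1 := by simp [hx]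
      rw [this]
      refine tendsto_const_nhds.congr' ?_
      filter_upwards [self_mem_nhdsWithin] with y hy
      have hy : k < y := hy
      rw [max_eq_left (by linarith), max_eq_left (by linarith),
        show y - x - (k - x) = y - k by ring, div_self (by linarith)]
    · have : (Iic k).indicator (1 : ℝ → ℝ) x = 0 := by simp [hx]
      rw [this]
      push Not at hx
      refine tendsto_const_nhds.congr' ?_
      filter_upwards [(eventually_lt_nhds hx).filter_mono nhdsWithin_le_nhds] with y hy
      rw [max_eq_right (by linarith), max_eq_right (by linarith)]
      simp

theorem tendsto_putPot_atBot {χ : Measure ℝ} (hχ : Integrable (fun x : ℝ => x) χ) :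
    Tendsto (putPot χ) atBot (𝓝 0) := by
  have : Tendsto (putPot χ) atBot (𝓝 (∫ _, (0 : ℝ) ∂χ)) := by
    refine tendsto_integral_filter_of_dominated_convergence (fun x => |x|) ?_ ?_ hχ.abs ?_
    · exact Eventually.of_forall fun y => by fun_prop
    · filter_upwards [eventually_le_atBot 0] with k hk
      refine Eventually.of_forall fun x => ?_
      rw [Real.norm_eq_abs, abs_of_nonneg (le_max_right _ _)]
      exact max_le (by linarith [neg_abs_le x]) (abs_nonneg x)
    · refine Eventually.of_forall fun x => tendsto_const_nhds.congr' ?_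
      filter_upwards [eventually_le_atBot x] with k hk
      rw [max_eq_right (by linarith)]
  simpa using this

theorem tendsto_callPot_atTop {χ : Measure ℝ} (hχ : Integrable (fun x : ℝ => x) χ) :
    Tendsto (callPot χ) atTop (𝓝 0) := by
  have : Tendsto (callPot χ) atTop (𝓝 (∫ _, (0 : ℝ) ∂χ)) := by
    refine tendsto_integral_filter_of_dominated_convergence (fun x => |x|) ?_ ?_ hχ.abs ?_
    · exact Eventually.of_forall fun y => by fun_prop
    · filter_upwards [eventually_ge_atTop 0] with k hk
      refine Eventually.of_forall fun x => ?_
      rw [Real.norm_eq_abs, abs_of_nonneg (le_max_right _ _)]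
      exact max_le (by linarith [le_abs_self x]) (abs_nonneg x)
    · refine Eventually.of_forall fun x => tendsto_const_nhds.congr' ?_
      filter_upwards [eventually_ge_atTop x] with k hk
      rw [max_eq_right (by linarith)]
  simpa using this

theorem eq_of_putPot_eq {χ : Measure ℝ} [IsFiniteMeasure χ] (hη : Integrable (fun x : ℝ => x) η)
    (hχ : Integrable (fun x : ℝ => x) χ) (h : ∀ k, putPot η k = putPot χ k) : η = χ := by
  refine Measure.ext_of_Iic _ _ fun a => ?_
  have h1 := hasDerivWithinAt_putPot hη a
  rw [funext h] at h1
  have := (uniqueDiffWithinAt_Ioi a).eq_deriv _ h1 (hasDerivWithinAt_putPot hχ a)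
  rwa [measureReal_def, measureReal_def,
    ENNReal.toReal_eq_toReal_iff' (measure_ne_top _ _) (measure_ne_top _ _)] at this

theorem putPot_add {χ : Measure ℝ} [IsFiniteMeasure χ] (hη : Integrable (fun x : ℝ => x) η)
    (hχ : Integrable (fun x : ℝ => x) χ) (k : ℝ) :
    putPot (η + χ) k = putPot η k + putPot χ k :=
  integral_add_measure (integrable_put hη k) (integrable_put hχ k)

theorem callPot_add {χ : Measure ℝ} [IsFiniteMeasure χ] (hη : Integrable (fun x : ℝ => x) η)
    (hχ : Integrable (fun x : ℝ => x) χ) (k : ℝ) :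
    callPot (η + χ) k = callPot η k + callPot χ k :=
  integral_add_measure (integrable_call hη k) (integrable_call hχ k)

end potentials

/-! ### Finiteness and sign of the gaps `p` and `c` -/

section gaps

variable {μ ν : Measure ℝ} [IsFiniteMeasure μ] [IsFiniteMeasure ν]

/-- Each potential differs from `k⁺` times the mass by at most the absolute first moment; the mass
comparison absorbs the linear growth. -/
theorem bddAbove_putPot_sub (hμ : Integrable (fun x : ℝ => x) μ)
    (hν : Integrable (fun x : ℝ => x) ν) (h : μ.real univ ≤ ν.real univ) :
    BddAbove (range fun k => putPot μ k - putPot ν k) := by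
  refine ⟨(∫ x, |x| ∂μ) + ∫ x, |x| ∂ν, ?_⟩
  rintro _ ⟨k, rfl⟩
  have hμ0 : 0 ≤ ∫ x, |x| ∂μ := integral_nonneg fun _ => abs_nonneg _
  have hν0 : 0 ≤ ∫ x, |x| ∂ν := integral_nonneg fun _ => abs_nonneg _
  have h1 : putPot μ k ≤ max k 0 * μ.real univ + ∫ x, |x| ∂μ := by
    have : putPot μ k ≤ ∫ x, (max k 0 + |x|) ∂μ :=
      integral_mono (integrable_put hμ k) ((integrable_const _).add hμ.abs) fun x =>
        max_le (by simp only; linarith [neg_abs_le x, le_max_left k 0])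
          (add_nonneg (le_max_right _ _) (abs_nonneg x))
    rw [integral_add (integrable_const _) hμ.abs] at this
    simpa [mul_comm] using this
  have h2 : max k 0 * ν.real univ - ∫ x, |x| ∂ν ≤ putPot ν k := by
    have : ∫ x, (max k 0 - |x|) ∂ν ≤ putPot ν k :=
      integral_mono ((integrable_const _).sub hν.abs) (integrable_put hν k) fun x => by
        rcases le_total k 0 with hk | hk
        · exact le_max_of_le_right (by simp only [max_eq_right hk]; linarith [abs_nonneg x])
        · exact le_max_of_le_left (by simp only [max_eq_left hk]; linarith [le_abs_self x])
    rw [integral_sub (integrable_const _) hν.abs] at this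
    simpa [mul_comm] using this
  have h3 : max k 0 * μ.real univ ≤ max k 0 * ν.real univ := by gcongr
  simp only
  linarith

theorem bddAbove_callPot_sub (hμ : Integrable (fun x : ℝ => x) μ)
    (hν : Integrable (fun x : ℝ => x) ν) (h : μ.real univ ≤ ν.real univ) :
    BddAbove (range fun k => callPot μ k - callPot ν k) := by
  refine ⟨(∫ x, |x| ∂μ) + ∫ x, |x| ∂ν, ?_⟩
  rintro _ ⟨k, rfl⟩
  have h1 : callPot μ k ≤ max (-k) 0 * μ.real univ + ∫ x, |x| ∂μ := by
    have : callPot μ k ≤ ∫ x, (max (-k) 0 + |x|) ∂μ :=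
      integral_mono (integrable_call hμ k) ((integrable_const _).add hμ.abs) fun x =>
        max_le (by simp only; linarith [le_abs_self x, le_max_left (-k) 0])
          (add_nonneg (le_max_right _ _) (abs_nonneg x))
    rw [integral_add (integrable_const _) hμ.abs] at this
    simpa [mul_comm] using this
  have h2 : max (-k) 0 * ν.real univ - ∫ x, |x| ∂ν ≤ callPot ν k := by
    have : ∫ x, (max (-k) 0 - |x|) ∂ν ≤ callPot ν k :=
      integral_mono ((integrable_const _).sub hν.abs) (integrable_call hν k) fun x => by
        rcases le_total (-k) 0 with hk | hk
        · exact le_max_of_le_right (by simp only [max_eq_right hk]; linarith [abs_nonneg x])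
        · exact le_max_of_le_left (by simp only [max_eq_left hk]; linarith [neg_abs_le x])
    rw [integral_sub (integrable_const _) hν.abs] at this
    simpa [mul_comm] using this
  have h3 : max (-k) 0 * μ.real univ ≤ max (-k) 0 * ν.real univ := by gcongr
  simp only
  linarith

theorem le_putGap (hμ : Integrable (fun x : ℝ => x) μ) (hν : Integrable (fun x : ℝ => x) ν)
    (h : μ.real univ ≤ ν.real univ) (k : ℝ) : putPot μ k - putPot ν k ≤ putGap μ ν :=
  le_ciSup (bddAbove_putPot_sub hμ hν h) k

theorem le_callGap (hμ : Integrable (fun x : ℝ => x) μ) (hν : Integrable (fun x : ℝ => x) ν)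
    (h : μ.real univ ≤ ν.real univ) (k : ℝ) : callPot μ k - callPot ν k ≤ callGap μ ν :=
  le_ciSup (bddAbove_callPot_sub hμ hν h) k

theorem putGap_nonneg (hμ : Integrable (fun x : ℝ => x) μ) (hν : Integrable (fun x : ℝ => x) ν)
    (h : μ.real univ ≤ ν.real univ) : 0 ≤ putGap μ ν := by
  have := (tendsto_putPot_atBot hμ).sub (tendsto_putPot_atBot hν)
  rw [sub_zero] at this
  exact le_of_tendsto this (Eventually.of_forall (le_putGap hμ hν h))

theorem callGap_nonneg (hμ : Integrable (fun x : ℝ => x) μ) (hν : Integrable (fun x : ℝ => x) ν)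
    (h : μ.real univ ≤ ν.real univ) : 0 ≤ callGap μ ν := by
  have := (tendsto_callPot_atTop hμ).sub (tendsto_callPot_atTop hν)
  rw [sub_zero] at this
  exact le_of_tendsto this (Eventually.of_forall (le_callGap hμ hν h))

theorem isGLB_putPot_sub (hμ : Integrable (fun x : ℝ => x) μ)
    (hν : Integrable (fun x : ℝ => x) ν) (h : μ.real univ ≤ ν.real univ) :
    IsGLB (range fun k => putPot ν k - putPot μ k) (-putGap μ ν) := by
  constructor
  · rintro _ ⟨k, rfl⟩
    have := le_putGap hμ hν h k
    simp only; linarith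
  · intro b hb
    have : putGap μ ν ≤ -b := ciSup_le fun k => by
      have := hb ⟨k, rfl⟩
      simp only at this; linarith
    linarith

theorem isGLB_callPot_sub (hμ : Integrable (fun x : ℝ => x) μ)
    (hν : Integrable (fun x : ℝ => x) ν) (h : μ.real univ ≤ ν.real univ) :
    IsGLB (range fun k => callPot ν k - callPot μ k) (-callGap μ ν) := by
  constructor
  · rintro _ ⟨k, rfl⟩
    have := le_callGap hμ hν h k
    simp only; linarith
  · intro b hb
    have : callGap μ ν ≤ -b := ciSup_le fun k => by
      have := hb ⟨k, rfl⟩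
      simp only at this; linarith
    linarith

end gaps

/-! ### The distributional second derivative of a potential -/

/-- The put payoff is a fundamental solution of the second derivative: `(k - x) φ' - φ` is a
primitive of `(k - x) φ''`. -/
theorem integral_put_mul_iteratedDeriv {φ : ℝ → ℝ} (hφ : ContDiff ℝ ∞ φ)
    (hc : HasCompactSupport φ) (x : ℝ) :
    ∫ k, max (k - x) 0 * iteratedDeriv 2 φ k = φ x := by
  have hφ1 : ContDiff ℝ ∞ (deriv φ) := (contDiff_infty_iff_deriv.1 hφ).2
  have hφ2 : ContDiff ℝ ∞ (deriv (deriv φ)) := (contDiff_infty_iff_deriv.1 hφ1).2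
  have h2 : iteratedDeriv 2 φ = deriv (deriv φ) := by
    rw [iteratedDeriv_succ, iteratedDeriv_one]
  have hd : ∀ k, HasDerivAt (fun k => (k - x) * deriv φ k - φ k)
      ((k - x) * deriv (deriv φ) k) k := fun k => by
    have e1 := (hφ.differentiable (by simp) k).hasDerivAt
    have e2 := (hφ1.differentiable (by simp) k).hasDerivAt
    exact ((((hasDerivAt_id k).sub_const x).mul e2).sub e1).congr_deriv (by simp)
  have hcont : Continuous fun k => (k - x) * deriv (deriv φ) k :=
    (continuous_id.sub continuous_const).mul hφ2.continuous
  have hint : Integrable fun k => (k - x) * deriv (deriv φ) k :=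
    hcont.integrable_of_hasCompactSupport (hc.deriv.deriv.mul_left)
  have hlim : Tendsto (fun k => (k - x) * deriv φ k - φ k) atTop (𝓝 0) := by
    have hcs : HasCompactSupport fun k => (k - x) * deriv φ k - φ k :=
      (hc.deriv.mul_left (f := fun k => k - x)).sub hc
    exact hcs.is_zero_at_infty.mono_left atTop_le_cocompact
  have := integral_Ioi_of_hasDerivAt_of_tendsto' (a := x) (fun k _ => hd k) hint.integrableOn hlim
  have h3 : ∫ k, max (k - x) 0 * iteratedDeriv 2 φ k =
      ∫ k in Ioi x, (k - x) * deriv (deriv φ) k := by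
    rw [← integral_indicator measurableSet_Ioi, h2]
    congr 1 with k
    by_cases hk : x < k
    · simp [hk, hk.le]
    · simp [hk, not_lt.1 hk]
  rw [h3, this]
  simp

theorem integral_iteratedDeriv_two {φ : ℝ → ℝ} (hφ : ContDiff ℝ ∞ φ)
    (hc : HasCompactSupport φ) : ∫ k, iteratedDeriv 2 φ k = 0 := by
  have hφ1 : ContDiff ℝ ∞ (deriv φ) := (contDiff_infty_iff_deriv.1 hφ).2
  have hφ2 : ContDiff ℝ ∞ (deriv (deriv φ)) := (contDiff_infty_iff_deriv.1 hφ1).2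
  rw [iteratedDeriv_succ, iteratedDeriv_one]
  exact integral_eq_zero_of_hasDerivAt_of_integrable
    (fun k => (hφ1.differentiable (by simp) k).hasDerivAt)
    (hφ2.continuous.integrable_of_hasCompactSupport hc.deriv.deriv)
    (hφ1.continuous.integrable_of_hasCompactSupport hc.deriv)

/-- Up to a constant, the potential of a measure has this measure as its second derivative. -/
theorem isSecondDistribDeriv_putPot_add {η : Measure ℝ} [IsFiniteMeasure η]
    (hη : Integrable (fun x : ℝ => x) η) (c : ℝ) :
    IsSecondDistribDeriv (fun k => putPot η k + c) η := by
  have hcont := continuous_putPot hη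
  refine ⟨(hcont.add continuous_const).locallyIntegrable, inferInstance, fun φ hφ hc => ?_⟩
  have hφ1 : ContDiff ℝ ∞ (deriv φ) := (contDiff_infty_iff_deriv.1 hφ).2
  have hφ2 : Continuous (iteratedDeriv 2 φ) := by
    rw [iteratedDeriv_succ, iteratedDeriv_one]
    exact (contDiff_infty_iff_deriv.1 hφ1).2.continuous
  have hcs : HasCompactSupport (iteratedDeriv 2 φ) := by
    rw [iteratedDeriv_succ, iteratedDeriv_one]
    exact hc.deriv.deriv
  have hi : Integrable (iteratedDeriv 2 φ) := hφ2.integrable_of_hasCompactSupport hcs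
  have hki : Integrable fun k => k * iteratedDeriv 2 φ k :=
    (continuous_id.mul hφ2).integrable_of_hasCompactSupport hcs.mul_left
  have hprod : Integrable (Function.uncurry fun k x => max (k - x) 0 * iteratedDeriv 2 φ k)
      ((volume : Measure ℝ).prod η) := by
    have hsub : Integrable (fun z : ℝ × ℝ =>
        z.1 * iteratedDeriv 2 φ z.1 * 1 - iteratedDeriv 2 φ z.1 * z.2) (volume.prod η) :=
      (hki.mul_prod (integrable_const (1 : ℝ))).sub (hi.mul_prod hη)
    refine hsub.mono ?_ (Eventually.of_forall fun z => ?_)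
    · exact Continuous.aestronglyMeasurable (by unfold Function.uncurry; fun_prop)
    · rw [show z.1 * iteratedDeriv 2 φ z.1 * 1 - iteratedDeriv 2 φ z.1 * z.2
        = (z.1 - z.2) * iteratedDeriv 2 φ z.1 by ring]
      simp only [Function.uncurry, norm_mul]
      gcongr
      rw [Real.norm_eq_abs, abs_of_nonneg (le_max_right _ _)]
      exact max_le (le_abs_self _) (abs_nonneg _)
  have hpi : Integrable fun k => putPot η k * iteratedDeriv 2 φ k :=
    (hcont.mul hφ2).integrable_of_hasCompactSupport hcs.mul_left
  calc ∫ k, (putPot η k + c) * iteratedDeriv 2 φ k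
      = (∫ k, putPot η k * iteratedDeriv 2 φ k) + c * ∫ k, iteratedDeriv 2 φ k := by
        rw [← integral_const_mul, ← integral_add hpi (hi.const_mul c)]
        simp only [add_mul]
    _ = ∫ k, ∫ x, max (k - x) 0 * iteratedDeriv 2 φ k ∂η := by
        rw [integral_iteratedDeriv_two hφ hc, mul_zero, add_zero]
        simp only [putPot, integral_mul_const]
    _ = ∫ x, (∫ k, max (k - x) 0 * iteratedDeriv 2 φ k) ∂η := integral_integral_swap hprod
    _ = ∫ x, φ x ∂η := by simp only [integral_put_mul_iteratedDeriv hφ hc]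

/-! ### Existence of the shadow -/

theorem eq_zero_of_tendsto_affine_atTop {α β : ℝ}
    (h : Tendsto (fun x : ℝ => α * x + β) atTop (𝓝 0)) : α = 0 ∧ β = 0 := by
  have h1 := (h.comp (tendsto_atTop_add_const_right atTop 1 tendsto_id)).sub h
  have h2 : Tendsto (fun _ : ℝ => α) atTop (𝓝 (0 - 0)) :=
    h1.congr fun x => by simp only [Function.comp_apply, id]; ring
  have hα : α = 0 := by simpa using tendsto_nhds_unique tendsto_const_nhds h2
  subst hα
  simp only [zero_mul, zero_add] at h
  exact ⟨rfl, tendsto_nhds_unique tendsto_const_nhds h⟩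

theorem eq_zero_of_tendsto_affine_atBot {α β : ℝ}
    (h : Tendsto (fun x : ℝ => α * x + β) atBot (𝓝 0)) : α = 0 ∧ β = 0 := by
  have h1 : Tendsto (fun x : ℝ => -α * x + β) atTop (𝓝 0) :=
    (h.comp tendsto_neg_atTop_atBot).congr fun x => by simp
  obtain ⟨h2, h3⟩ := eq_zero_of_tendsto_affine_atTop h1
  exact ⟨neg_eq_zero.1 h2, h3⟩

/-- The right derivative of a convex function, as a Stieltjes function. -/
noncomputable def rightDerivStieltjes {f : ℝ → ℝ} (hf : ConvexOn ℝ univ f) :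
    StieltjesFunction ℝ where
  toFun x := derivWithin f (Ioi x) x
  mono' x y hxy := hf.monotoneOn_rightDeriv (by simp) (by simp) hxy
  right_continuous' := rightDeriv_continuousWithinAt hf

theorem hasDerivWithinAt_rightDerivStieltjes {f : ℝ → ℝ} (hf : ConvexOn ℝ univ f) (x : ℝ) :
    HasDerivWithinAt f (rightDerivStieltjes hf x) (Ioi x) x :=
  hf.hasDerivWithinAt_rightDeriv_of_mem_interior (by simp)

theorem rightDerivStieltjes_eq {f : ℝ → ℝ} (hf : ConvexOn ℝ univ f) {x d : ℝ}
    (h : HasDerivWithinAt f d (Ioi x) x) : rightDerivStieltjes hf x = d :=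
  (uniqueDiffWithinAt_Ioi x).eq_deriv _ (hasDerivWithinAt_rightDerivStieltjes hf x) h

theorem tendsto_measureReal_Iic_atBot (η : Measure ℝ) [IsFiniteMeasure η] :
    Tendsto (fun x => η.real (Iic x)) atBot (𝓝 0) := by
  have h1 := tendsto_measure_iInter_atBot (μ := η) (s := fun x : ℝ => Iic x)
    (fun _ => measurableSet_Iic.nullMeasurableSet) (fun _ _ h => Iic_subset_Iic.2 h)
    ⟨0, measure_ne_top _ _⟩
  rw [iInter_Iic_eq_empty_iff.2 (by simp), measure_empty] at h1
  exact (ENNReal.tendsto_toReal ENNReal.zero_ne_top).comp h1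

theorem measure_rightDerivStieltjes_putPot {η : Measure ℝ} [IsFiniteMeasure η]
    (hη : Integrable (fun x : ℝ => x) η) :
    (rightDerivStieltjes (convexOn_putPot hη)).measure = η := by
  have h1 : ∀ x, rightDerivStieltjes (convexOn_putPot hη) x = η.real (Iic x) := fun x =>
    rightDerivStieltjes_eq _ (hasDerivWithinAt_putPot hη x)
  symm
  refine Measure.ext_of_Iic _ _ fun a => ?_
  rw [StieltjesFunction.measure_Iic _ (l := 0), h1, sub_zero, ofReal_measureReal]
  exact (tendsto_measureReal_Iic_atBot η).congr fun x => (h1 x).symm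

/-- A decomposition of the potential of `ν` into two convex functions comes from a decomposition
of `ν`. -/
theorem exists_le_putPot_eq {ν : Measure ℝ} [IsFiniteMeasure ν]
    (hν : Integrable (fun x : ℝ => x) ν) {D : ℝ → ℝ} {c : ℝ} (hD : ConvexOn ℝ univ D)
    (hF : ConvexOn ℝ univ fun k => putPot ν k - D k)
    (hlim : Tendsto (fun k => putPot ν k - D k) atBot (𝓝 c)) :
    ∃ S ≤ ν, ∀ k, putPot S k = putPot ν k - D k - c := by
  set N := rightDerivStieltjes (convexOn_putPot hν) with hN
  set G := rightDerivStieltjes hD with hG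
  set Fs := rightDerivStieltjes hF with hFs
  have hFd : ∀ x, HasDerivWithinAt (fun k => putPot ν k - D k) (N x - G x) (Ioi x) x := fun x =>
    (hasDerivWithinAt_rightDerivStieltjes _ x).sub (hasDerivWithinAt_rightDerivStieltjes _ x)
  have hFx : ∀ x, Fs x = N x - G x := fun x => rightDerivStieltjes_eq _ (hFd x)
  have hNx : ∀ x, 0 ≤ N x := fun x => by
    rw [hN, rightDerivStieltjes_eq _ (hasDerivWithinAt_putPot hν x)]
    exact measureReal_nonneg
  have hsum : Fs + G = N := by
    ext x
    simp [hFx]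
  have hSν : Fs.measure + G.measure = ν := by
    rw [← StieltjesFunction.measure_add, hsum, measure_rightDerivStieltjes_putPot hν]
  have hle : Fs.measure ≤ ν := by
    rw [← hSν]; exact Measure.le_add_right le_rfl
  have : IsFiniteMeasure Fs.measure := isFiniteMeasure_of_le ν hle
  have hSi : Integrable (fun x : ℝ => x) Fs.measure := hν.mono_measure hle
  refine ⟨Fs.measure, hle, ?_⟩
  -- If `Fs` fell to `-∞`, then `N = Fs + G` would become negative, as `G` is bounded above on the
  -- left half-line.
  obtain ⟨l, hl⟩ : ∃ l, Tendsto Fs atBot (𝓝 l) := by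
    rcases tendsto_atBot_of_monotone Fs.mono with h | h
    · obtain ⟨x, hx1, hx2⟩ := ((h.eventually_lt_atBot (-G 0)).and (eventually_le_atBot 0)).exists
      have h1 := G.mono hx2
      have h2 := hNx x
      rw [hFx] at hx1
      linarith
    · exact h
  have hSreal : ∀ x, Fs.measure.real (Iic x) = Fs x - l := fun x => by
    rw [measureReal_def, Fs.measure_Iic hl, ENNReal.toReal_ofReal]
    exact sub_nonneg.2 (Fs.mono.le_of_tendsto hl x)
  -- `u` has zero right derivative, hence is constant; the limit at `-∞` then forces `l = 0` and `u
  -- = -c`.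
  set u : ℝ → ℝ := fun x => putPot Fs.measure x - (putPot ν x - D x) + l * x with hu
  have huc : Continuous u :=
    ((continuous_putPot hSi).sub hF.continuous_real).add (continuous_const.mul continuous_id)
  have hud : ∀ x, HasDerivWithinAt u 0 (Ici x) x := fun x => by
    refine HasDerivWithinAt.Ici_of_Ioi ?_
    refine (((hasDerivWithinAt_putPot hSi x).sub (hFd x)).add
      ((hasDerivWithinAt_id x (Ioi x)).const_mul l)).congr_deriv ?_
    rw [hSreal, hFx]; ring
  have huK : ∀ x, u x = u 0 := fun x => by
    rcases le_total 0 x with h | h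
    · exact constant_of_has_deriv_right_zero huc.continuousOn (fun y _ => hud y) x ⟨h, le_rfl⟩
    · exact (constant_of_has_deriv_right_zero huc.continuousOn (fun y _ => hud y) 0
        ⟨h, le_rfl⟩).symm
  have hlim2 : Tendsto (fun x => l * x + (-u 0 - c)) atBot (𝓝 0) := by
    have := ((tendsto_putPot_atBot hSi).sub hlim).neg.sub (tendsto_const_nhds (x := c))
    rw [show -(0 - c) - c = 0 by ring] at this
    refine this.congr fun x => ?_
    rw [← huK x]
    simp only [hu]; ring
  obtain ⟨hl0, hK⟩ := eq_zero_of_tendsto_affine_atBot hlim2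
  intro k
  have := huK k
  simp only [hu, hl0, zero_mul, add_zero] at this hK ⊢
  linarith

theorem hasConvMinorant_putPot_sub {μ ν : Measure ℝ} [IsFiniteMeasure μ] [IsFiniteMeasure ν]
    (hμ : Integrable (fun x : ℝ => x) μ) (hν : Integrable (fun x : ℝ => x) ν)
    (h : μ.real univ ≤ ν.real univ) : HasConvMinorant fun x => putPot ν x - putPot μ x :=
  ⟨_, convexOn_const _ convex_univ, fun x => (isGLB_putPot_sub hμ hν h).1 ⟨x, rfl⟩⟩

theorem exists_shadow {μ ν : Measure ℝ} [IsFiniteMeasure μ] [IsFiniteMeasure ν]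
    (hμ : Integrable (fun x : ℝ => x) μ) (hν : Integrable (fun x : ℝ => x) ν)
    (h : μ.real univ ≤ ν.real univ) :
    ∃ S ≤ ν, (∀ k, putPot S k = shadowFun μ ν k - putGap μ ν) ∧ S.real univ = μ.real univ ∧
      mean S = mean μ + putGap μ ν - callGap μ ν := by
  have hm := hasConvMinorant_putPot_sub hμ hν h
  have hbot : Tendsto (convMinorant fun x => putPot ν x - putPot μ x) atBot
      (𝓝 (-putGap μ ν)) :=
    tendsto_convMinorant_atBot ((tendsto_putPot_atBot hν).sub (tendsto_putPot_atBot hμ))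
      (isGLB_putPot_sub hμ hν h)
  have htop : Tendsto (convMinorant fun x => callPot ν x - callPot μ x) atTop
      (𝓝 (-callGap μ ν)) :=
    tendsto_convMinorant_atTop ((tendsto_callPot_atTop hν).sub (tendsto_callPot_atTop hμ))
      (isGLB_callPot_sub hμ hν h)
  obtain ⟨S, hSν, hS⟩ := exists_le_putPot_eq (c := putGap μ ν) hν hm.convexOn
    (convexOn_sub_convMinorant (convexOn_putPot hν) (convexOn_putPot hμ) hm) (by
      simpa using (tendsto_putPot_atBot hν).sub hbot)
  have : IsFiniteMeasure S := isFiniteMeasure_of_le ν hSν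
  have hSi : Integrable (fun x : ℝ => x) S := hν.mono_measure hSν
  have hcall : (fun x => callPot ν x - callPot μ x) = fun x => (putPot ν x - putPot μ x) +
      ((μ.real univ - ν.real univ) * x + (mean ν - mean μ)) := by
    funext x
    rw [callPot_eq hν, callPot_eq hμ]; ring
  rw [hcall] at htop
  -- In call form every term has a limit at `+∞`. By parity the combination is affine, so its
  -- vanishing limit determines mass and mean.
  have hlim : Tendsto (fun x => (S.real univ - μ.real univ) * x +
      (mean μ + putGap μ ν - callGap μ ν - mean S)) atTop (𝓝 0) := by
    have := (((tendsto_callPot_atTop hν).sub htop).sub (tendsto_callPot_atTop hSi)).sub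
      (tendsto_const_nhds (x := callGap μ ν))
    rw [show 0 - -callGap μ ν - 0 - callGap μ ν = 0 by ring] at this
    refine this.congr fun x => ?_
    rw [hm.convMinorant_add_affine, callPot_eq hν, callPot_eq hSi, hS]
    ring
  obtain ⟨h1, h2⟩ := eq_zero_of_tendsto_affine_atTop hlim
  exact ⟨S, hSν, hS, by linarith, by linarith⟩

/-- Removing the shadow of `μ₁` lowers the put gap of the remaining part by `p_{μ₁,ν}`. -/
theorem putGap_le_sub {μ₁ μ₂ ν S R : Measure ℝ} [IsFiniteMeasure μ₁] [IsFiniteMeasure μ₂]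
    [IsFiniteMeasure S] [IsFiniteMeasure R] (hμ₁ : Integrable (fun x : ℝ => x) μ₁)
    (hμ₂ : Integrable (fun x : ℝ => x) μ₂) (hS : Integrable (fun x : ℝ => x) S)
    (hR : Integrable (fun x : ℝ => x) R) (hSR : S + R = ν)
    (h : μ₁.real univ + μ₂.real univ ≤ ν.real univ)
    (hpot : ∀ k, putPot S k = shadowFun μ₁ ν k - putGap μ₁ ν) :
    putGap μ₂ R ≤ putGap (μ₁ + μ₂) ν - putGap μ₁ ν := by
  subst hSR
  have hν : Integrable (fun x : ℝ => x) (S + R) := hS.add_measure hR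
  have h12 : Integrable (fun x : ℝ => x) (μ₁ + μ₂) := hμ₁.add_measure hμ₂
  refine ciSup_le fun k => ?_
  -- `P_{μ₂} - p_{μ₁+μ₂,ν}` is a convex minorant of `P_ν - P_{μ₁}`, while `P_R` is the largest one
  -- plus `p_{μ₁,ν}`.
  have h1 := le_convMinorant (f := fun x => putPot (S + R) x - putPot μ₁ x)
    (g := fun x => putPot μ₂ x + (0 * x + -putGap (μ₁ + μ₂) (S + R)))
    ((convexOn_putPot hμ₂).add (convexOn_affine _ _)) (fun x => by
      have := le_putGap h12 hν (by rwa [measureReal_add_apply]) x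
      rw [putPot_add hμ₁ hμ₂] at this
      linarith) k
  have h2 := hpot k
  have h3 := putPot_add hS hR k
  unfold shadowFun at h2
  linarith

theorem mean_add {μ ν : Measure ℝ} (hμ : Integrable (fun x : ℝ => x) μ)
    (hν : Integrable (fun x : ℝ => x) ν) : mean (μ + ν) = mean μ + mean ν :=
  integral_add_measure hμ hν

/-- Removing the shadow of `μ₁` lowers the call gap of the remaining part by `c_{μ₁,ν}`. -/
theorem callGap_le_sub {μ₁ μ₂ ν S R : Measure ℝ} [IsFiniteMeasure μ₁] [IsFiniteMeasure μ₂]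
    [IsFiniteMeasure S] [IsFiniteMeasure R] (hμ₁ : Integrable (fun x : ℝ => x) μ₁)
    (hμ₂ : Integrable (fun x : ℝ => x) μ₂) (hS : Integrable (fun x : ℝ => x) S)
    (hR : Integrable (fun x : ℝ => x) R) (hSR : S + R = ν)
    (h : μ₁.real univ + μ₂.real univ ≤ ν.real univ)
    (hpot : ∀ k, putPot S k = shadowFun μ₁ ν k - putGap μ₁ ν)
    (hmass : S.real univ = μ₁.real univ)
    (hmean : mean S = mean μ₁ + putGap μ₁ ν - callGap μ₁ ν) :
    callGap μ₂ R ≤ callGap (μ₁ + μ₂) ν - callGap μ₁ ν := by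
  subst hSR
  have hν : Integrable (fun x : ℝ => x) (S + R) := hS.add_measure hR
  have h12 : Integrable (fun x : ℝ => x) (μ₁ + μ₂) := hμ₁.add_measure hμ₂
  have hmassν : (S + R).real univ = S.real univ + R.real univ := measureReal_add_apply
  refine ciSup_le fun k => ?_
  -- This is the minorant coming from the call gap of `μ₁ + μ₂`, rewritten in puts by parity.
  have hconv : ConvexOn ℝ univ (fun x => putPot μ₂ x +
      ((-μ₂.real univ + R.real univ) * x + (mean μ₂ + mean μ₁ - mean (S + R) -
        callGap (μ₁ + μ₂) (S + R)))) :=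
    (convexOn_putPot hμ₂).add (convexOn_affine _ _)
  have h1 := le_convMinorant (f := fun x => putPot (S + R) x - putPot μ₁ x) hconv (fun x => by
      have := le_callGap h12 hν (by rwa [measureReal_add_apply]) x
      rw [callPot_add hμ₁ hμ₂, callPot_eq hμ₁, callPot_eq hμ₂, callPot_eq hν, hmassν,
        hmass] at this
      linarith) k
  have h2 := hpot k
  have h3 := putPot_add hS hR k
  have h4 := mean_add hS hR
  rw [callPot_eq hμ₂, callPot_eq hR]
  unfold shadowFun at h2
  linarith

/-! ### Barycentres of couplings -/

theorem _root_.LipschitzWith.integrable_comp_real {α : Type*} [MeasurableSpace α] {m : Measure α}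
    [IsFiniteMeasure m] {K : NNReal} {φ : ℝ → ℝ} (hφ : LipschitzWith K φ) {f : α → ℝ}
    (hf : Integrable f m) : Integrable (fun x => φ (f x)) m := by
  refine (((integrable_const |φ 0|).add (hf.abs.const_mul (K : ℝ)))).mono
    (hφ.continuous.comp_aestronglyMeasurable hf.1) (Eventually.of_forall fun x => ?_)
  have h1 := hφ.dist_le_mul (f x) 0
  rw [Real.dist_eq, Real.dist_eq, sub_zero] at h1
  have h2 : |φ (f x)| ≤ |φ 0| + K * |f x| := by
    linarith [abs_sub_abs_le_abs_sub (φ (f x)) (φ 0)]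
  rw [Real.norm_eq_abs]
  exact h2.trans (le_abs_self _)

theorem integrable_snd_of_couplings {μ θ : Measure ℝ} {π : Measure (ℝ × ℝ)}
    (h : π ∈ couplings μ θ) : Integrable (fun z : ℝ × ℝ => z.2) π :=
  h.1.2.snd

theorem integrable_integral_kernel {μ : Measure ℝ} [SFinite μ] {κ : Kernel ℝ ℝ} [IsSFiniteKernel κ]
    {f : ℝ × ℝ → ℝ} (h : Integrable f (μ ⊗ₘ κ)) : Integrable (fun x => ∫ y, f (x, y) ∂κ x) μ := by
  -- The statement for kernels is used over a one-point parameter space.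
  have := Integrable.integral_compProd (κ := Kernel.const Unit μ) (η := Kernel.prodMkLeft Unit κ)
    (a := ()) h
  simpa using this

section barycentre

variable {μ θ : Measure ℝ} [IsFiniteMeasure μ] {κ : Kernel ℝ ℝ} [IsMarkovKernel κ]

theorem integrable_barycentre (h : μ ⊗ₘ κ ∈ couplings μ θ) :
    Integrable (fun x => ∫ y, y ∂κ x) μ :=
  integrable_integral_kernel (integrable_snd_of_couplings h)

theorem mean_eq_integral_barycentre (h : μ ⊗ₘ κ ∈ couplings μ θ) :
    mean θ = ∫ x, ∫ y, y ∂κ x ∂μ := by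
  rw [← Measure.integral_compProd (f := fun z : ℝ × ℝ => z.2) (integrable_snd_of_couplings h),
    mean, ← h.2.2]
  exact integral_map measurable_snd.aemeasurable aestronglyMeasurable_id

/-- Jensen's inequality in each fibre; the Lipschitz bound makes all integrals finite. -/
theorem integral_comp_barycentre_le (h : μ ⊗ₘ κ ∈ couplings μ θ) {φ : ℝ → ℝ} {K : NNReal}
    (hφ : ConvexOn ℝ univ φ) (hK : LipschitzWith K φ) :
    ∫ x, φ (∫ y, y ∂κ x) ∂μ ≤ ∫ y, φ y ∂θ := by
  have hi := integrable_snd_of_couplings h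
  have hi' : Integrable (fun z : ℝ × ℝ => φ z.2) (μ ⊗ₘ κ) := hK.integrable_comp_real hi
  have e : ∫ y, φ y ∂θ = ∫ x, ∫ y, φ y ∂κ x ∂μ := by
    rw [← Measure.integral_compProd (f := fun z : ℝ × ℝ => φ z.2) hi', ← h.2.2]
    exact integral_map measurable_snd.aemeasurable hK.continuous.aestronglyMeasurable
  rw [e]
  have hae := ((Measure.integrable_compProd_iff hi.1).1 hi).1
  refine integral_mono_ae (hK.integrable_comp_real (integrable_barycentre h))
    (integrable_integral_kernel hi') ?_
  filter_upwards [hae] with x hx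
  exact hφ.map_integral_le hK.continuous.continuousOn isClosed_univ (by simp) hx
    (hK.integrable_comp_real hx)

end barycentre

theorem exists_coupling_of_weakCost_lt {μ θ : Measure ℝ} [IsFiniteMeasure μ]
    (hμ : Integrable (fun x : ℝ => x) μ) {w : ℝ} (h : weakCost μ θ < ENNReal.ofReal w) :
    ∃ κ : Kernel ℝ ℝ, IsMarkovKernel κ ∧ μ ⊗ₘ κ ∈ couplings μ θ ∧
      ∫ x, |x - ∫ y, y ∂κ x| ∂μ < w := by
  unfold weakCost at h
  simp only [iInf_lt_iff] at h
  obtain ⟨π, hπ, κ, hκ, rfl, hlt⟩ := h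
  refine ⟨κ, hκ, hπ, ?_⟩
  have hi : Integrable (fun x => |x - ∫ y, y ∂κ x|) μ := (hμ.sub (integrable_barycentre hπ)).abs
  rw [← ofReal_integral_eq_lintegral_ofReal hi
    (Eventually.of_forall fun _ => abs_nonneg _)] at hlt
  exact (ENNReal.ofReal_lt_ofReal_iff_of_nonneg (integral_nonneg fun _ => abs_nonneg _)).1 hlt

theorem measureReal_univ_of_couplings {μ θ : Measure ℝ} {π : Measure (ℝ × ℝ)}
    (h : π ∈ couplings μ θ) : μ.real univ = θ.real univ := by
  rw [← h.2.1, ← h.2.2, map_measureReal_apply measurable_fst MeasurableSet.univ,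
    map_measureReal_apply measurable_snd MeasurableSet.univ]
  simp

theorem lipschitzWith_put (k : ℝ) : LipschitzWith 1 fun x : ℝ => max (k - x) 0 := by
  refine LipschitzWith.of_dist_le_mul fun x y => ?_
  rw [Real.dist_eq, Real.dist_eq, NNReal.coe_one, one_mul, abs_sub_comm x]
  refine (abs_max_sub_max_le_abs _ _ _).trans (le_of_eq ?_)
  congr 1; ring

/-- A bound on the transport cost splits into a bound on the puts and a bound on the calls. -/
theorem exists_bounds_of_weakCost_lt {μ θ : Measure ℝ} [IsFiniteMeasure μ] [IsFiniteMeasure θ]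
    (hμ : Integrable (fun x : ℝ => x) μ) (hθ : Integrable (fun x : ℝ => x) θ) {w : ℝ}
    (h : weakCost μ θ < ENNReal.ofReal w) :
    ∃ A B : ℝ, A + B < w ∧ A - B = mean θ - mean μ ∧
      (∀ k, putPot μ k - putPot θ k ≤ A) ∧ ∀ k, callPot μ k - callPot θ k ≤ B := by
  obtain ⟨κ, hκ, hπ, hlt⟩ := exists_coupling_of_weakCost_lt hμ h
  have hb := integrable_barycentre hπ
  set b : ℝ → ℝ := fun x => ∫ y, y ∂κ x with hbdef
  have hmean : mean θ = ∫ x, b x ∂μ := mean_eq_integral_barycentre hπ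
  have hA : Integrable (fun x => max (b x - x) 0) μ := (hb.sub hμ).pos_part
  have hB : Integrable (fun x => max (x - b x) 0) μ := (hμ.sub hb).pos_part
  have hdiff : (∫ x, max (b x - x) 0 ∂μ) - ∫ x, max (x - b x) 0 ∂μ = mean θ - mean μ := by
    rw [← integral_sub hA hB, hmean, mean, ← integral_sub hb hμ]
    refine integral_congr_ae (Eventually.of_forall fun x => ?_)
    rcases le_total x (b x) with h | h
    · simp only [max_eq_right (sub_nonpos.2 h), max_eq_left (sub_nonneg.2 h)]; ring
    · simp only [max_eq_right (sub_nonpos.2 h), max_eq_left (sub_nonneg.2 h)]; ring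
  have hput : ∀ k, putPot μ k - putPot θ k ≤ ∫ x, max (b x - x) 0 ∂μ := fun k => by
    have h1 : ∫ x, max (k - b x) 0 ∂μ ≤ putPot θ k :=
      integral_comp_barycentre_le hπ (convexOn_put' k) (lipschitzWith_put k)
    have hkb : Integrable (fun x => max (k - b x) 0) μ := ((integrable_const k).sub hb).pos_part
    -- Subadditivity of the positive part, applied to `k - x = (k - b x) + (b x - x)`.
    have h2 : putPot μ k ≤ ∫ x, (max (k - b x) 0 + max (b x - x) 0) ∂μ :=
      integral_mono (integrable_put hμ k)
        (hkb.add hA) fun x =>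
        max_le (by simp only; linarith [le_max_left (k - b x) 0, le_max_left (b x - x) 0])
          (add_nonneg (le_max_right _ _) (le_max_right _ _))
    rw [integral_add hkb hA] at h2
    linarith
  refine ⟨∫ x, max (b x - x) 0 ∂μ, ∫ x, max (x - b x) 0 ∂μ, ?_, hdiff, hput, fun k => ?_⟩
  · refine lt_of_le_of_lt (le_of_eq ?_) hlt
    rw [← integral_add hA hB]
    refine integral_congr_ae (Eventually.of_forall fun x => ?_)
    change _ = |x - b x|
    rcases le_total x (b x) with h | h
    · simp only [max_eq_right (sub_nonpos.2 h), max_eq_left (sub_nonneg.2 h),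
        abs_of_nonpos (sub_nonpos.2 h)]; ring
    · simp only [max_eq_right (sub_nonpos.2 h), max_eq_left (sub_nonneg.2 h),
        abs_of_nonneg (sub_nonneg.2 h)]; ring
  · have := hput k
    rw [callPot_eq hμ, callPot_eq hθ, measureReal_univ_of_couplings hπ]
    linarith

/-- A coupling of small cost has barycentres close to the identity in `L¹`: Jensen handles the
barycentres, the Lipschitz constant the error. -/
theorem integral_le_of_weakCost_eq_zero {η χ : Measure ℝ} [IsFiniteMeasure η]
    (hη : Integrable (fun x : ℝ => x) η) (h : weakCost η χ = 0) {φ : ℝ → ℝ} {K : NNReal}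
    (hφ : ConvexOn ℝ univ φ) (hK : LipschitzWith K φ) : ∫ x, φ x ∂η ≤ ∫ x, φ x ∂χ := by
  refine le_of_forall_pos_le_add fun ε hε => ?_
  -- `K + 1` rather than `K`, which may be zero.
  have hε' : 0 < ε / (K + 1) := by positivity
  obtain ⟨κ, hκ, hπ, hlt⟩ := exists_coupling_of_weakCost_lt (θ := χ) hη
    (h ▸ ENNReal.ofReal_pos.2 hε')
  have hb := integrable_barycentre hπ
  have h1 := integral_comp_barycentre_le hπ hφ hK
  have hφb := hK.integrable_comp_real hb
  have hφi := hK.integrable_comp_real hη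
  have h2 : ∫ x, φ x ∂η - ∫ x, φ (∫ y, y ∂κ x) ∂η ≤ K * ∫ x, |x - ∫ y, y ∂κ x| ∂η := by
    rw [← integral_sub hφi hφb, ← integral_const_mul]
    refine integral_mono (hφi.sub hφb) ((hη.sub hb).abs.const_mul _) fun x => ?_
    have := hK.dist_le_mul x (∫ y, y ∂κ x)
    rw [Real.dist_eq, Real.dist_eq] at this
    exact (le_abs_self _).trans this
  have h3 : (K : ℝ) * ∫ x, |x - ∫ y, y ∂κ x| ∂η ≤ ε := by
    calc (K : ℝ) * ∫ x, |x - ∫ y, y ∂κ x| ∂η ≤ (K + 1) * (ε / (K + 1)) := by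
          gcongr
          linarith
      _ = ε := by field_simp
  linarith

/-- A convex function is the increasing limit of convex Lipschitz functions. -/
theorem exists_lipschitz_approx {f : ℝ → ℝ} (hf : ConvexOn ℝ univ f) :
    ∃ g : ℕ → ℝ → ℝ, (∀ n, ConvexOn ℝ univ (g n)) ∧ (∀ n, ∃ K, LipschitzWith K (g n)) ∧
      Monotone g ∧ (∀ n, g n ≤ f) ∧ ∀ x, Tendsto (fun n => g n x) atTop (𝓝 (f x)) := by
  obtain ⟨l, c, hle, hsup⟩ :=
    hf.real_univ_sSup_of_nat_affine_eq hf.continuous_real.lowerSemicontinuous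
  set a : ℕ → ℝ → ℝ := fun i x => l i x + c i with ha
  have hle' : ∀ i, a i ≤ f := hle
  refine ⟨partialSups a, fun n => ?_, fun n => ?_, (partialSups a).monotone,
    fun n => partialSups_le _ _ _ fun i _ => hle' i, fun x => ?_⟩
  · induction n with
    | zero =>
      rw [partialSups_zero]
      exact ((l 0).toLinearMap.convexOn convex_univ).add (convexOn_const _ convex_univ)
    | succ n ih =>
      rw [partialSups_add_one]
      exact ih.sup (((l _).toLinearMap.convexOn convex_univ).add (convexOn_const _ convex_univ))
  · induction n with
    | zero =>
      rw [partialSups_zero]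
      exact ⟨_, (l 0).lipschitz.add (LipschitzWith.const (c 0))⟩
    | succ n ih =>
      obtain ⟨K, hK⟩ := ih
      rw [partialSups_add_one]
      exact ⟨_, hK.max ((l (n + 1)).lipschitz.add (LipschitzWith.const (c (n + 1))))⟩
  · have hb : BddAbove (range fun i => a i x) := ⟨f x, by rintro _ ⟨i, rfl⟩; exact hle' i x⟩
    have hsx : f x = ⨆ i, a i x := by
      conv_lhs => rw [← hsup]
      rw [iSup_apply]; rfl
    have hmono : Monotone fun n => partialSups a n x := fun i j hij =>
      (partialSups a).monotone hij x
    have e : ∀ n, partialSups a n x = partialSups (fun i => a i x) n := fun n =>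
      Pi.partialSups_apply a n x
    rw [hsx, ← ciSup_partialSups_eq hb]
    simp only [e] at hmono ⊢
    exact tendsto_atTop_ciSup hmono (bddAbove_range_partialSups.2 hb)

/-- Passes from Lipschitz to all convex functions by monotone approximation; a uniform `L¹` bound
and Fatou give integrability of the limit. -/
theorem convexLE_of_weakCost_eq_zero {η χ : Measure ℝ} [IsFiniteMeasure η] [IsFiniteMeasure χ]
    (hη : Integrable (fun x : ℝ => x) η) (hχ : Integrable (fun x : ℝ => x) χ)
    (h : weakCost η χ = 0) : ConvexLE η χ := by
  intro f hf hfi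
  obtain ⟨g, hgc, hgl, hgm, hgf, hlim⟩ := exists_lipschitz_approx hf
  choose K hK using hgl
  have hgη : ∀ n, Integrable (g n) η := fun n => (hK n).integrable_comp_real hη
  have hgχ : ∀ n, Integrable (g n) χ := fun n => (hK n).integrable_comp_real hχ
  have hbound : ∀ n, ∫ x, g n x ∂η ≤ ∫ x, f x ∂χ := fun n =>
    (integral_le_of_weakCost_eq_zero hη h (hgc n) (hK n)).trans
      (integral_mono (hgχ n) hfi (hgf n))
  have hmono : ∀ᵐ x ∂η, Monotone fun n => g n x :=
    Eventually.of_forall fun x _ _ hij => hgm hij x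
  have hfη : Integrable f η := by
    refine integrable_of_tendsto (Eventually.of_forall hlim) (fun n => (hgη n).1) ?_
    have hC : ∀ n, ∫⁻ x, ‖g n x‖ₑ ∂η ≤
        ENNReal.ofReal (∫ x, f x ∂χ - ∫ x, g 0 x ∂η + ∫ x, |g 0 x| ∂η) := fun n => by
      rw [← ofReal_integral_norm_eq_lintegral_enorm (hgη n)]
      refine ENNReal.ofReal_le_ofReal ?_
      have hn := hbound n
      have hsub : Integrable (fun x => g n x - g 0 x) η := (hgη n).sub (hgη 0)
      have h1 : ∫ x, ‖g n x‖ ∂η ≤ ∫ x, (g n x - g 0 x + |g 0 x|) ∂η := by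
        refine integral_mono (hgη n).norm (((hgη n).sub (hgη 0)).add (hgη 0).abs) fun x => ?_
        have h0 := hgm (Nat.zero_le n) x
        simp only [Real.norm_eq_abs]
        exact abs_le.2 ⟨by linarith [neg_abs_le (g 0 x)], by linarith [le_abs_self (g 0 x)]⟩
      rw [integral_add hsub (hgη 0).abs, integral_sub (hgη n) (hgη 0)] at h1
      linarith
    exact ((liminf_le_of_frequently_le' (Frequently.of_forall hC)).trans_lt
      ENNReal.ofReal_lt_top).ne
  exact ⟨hfη, le_of_tendsto' (integral_tendsto_of_tendsto_of_monotone hgη hfη hmono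
    (Eventually.of_forall hlim)) hbound⟩

/-! ### Transport by successive shadows -/

theorem eq_of_le_of_univ_le {χ θ : Measure ℝ} [IsFiniteMeasure θ] (h : χ ≤ θ)
    (hu : θ univ ≤ χ univ) : χ = θ := by
  have : IsFiniteMeasure χ := isFiniteMeasure_of_le θ h
  have h1 : θ - χ + χ = θ := Measure.sub_add_cancel_of_le h
  have h2 : (θ - χ) univ = 0 := by
    have h3 : (θ - χ) univ + χ univ ≤ 0 + χ univ := by
      rw [zero_add, ← Measure.add_apply, h1]; exact hu
    exact nonpos_iff_eq_zero.1 ((ENNReal.add_le_add_iff_right (measure_ne_top χ univ)).1 h3)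
  rw [Measure.measure_univ_eq_zero.1 h2, zero_add] at h1
  exact h1

/-- Finitely many pieces of a measure can be embedded one after the other by shadows. -/
theorem exists_embedding {ι : Type*} (s : Finset ι) (m : ι → Measure ℝ)
    [∀ i, IsFiniteMeasure (m i)] (hm : ∀ i, Integrable (fun x : ℝ => x) (m i)) :
    ∀ (ν : Measure ℝ) [IsFiniteMeasure ν], Integrable (fun x : ℝ => x) ν →
      (∑ i ∈ s, m i).real univ ≤ ν.real univ →
      ∃ θ : ι → Measure ℝ, ∑ i ∈ s, θ i ≤ ν ∧ (∀ i ∈ s, (θ i).real univ = (m i).real univ) ∧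
        ∑ i ∈ s, |mean (m i) - mean (θ i)| ≤
          putGap (∑ i ∈ s, m i) ν + callGap (∑ i ∈ s, m i) ν := by
  classical
  -- The target ν stays general, since the remaining pieces are embedded into `ν - S`.
  induction s using Finset.induction_on with
  | empty =>
    intro ν _ hν h
    refine ⟨fun _ => 0, by simpa using Measure.zero_le ν, by simp, ?_⟩
    have h0 : Integrable (fun x : ℝ => x) (0 : Measure ℝ) := integrable_zero_measure
    simp only [Finset.sum_empty] at h ⊢
    exact add_nonneg (putGap_nonneg h0 hν h) (callGap_nonneg h0 hν h)
  | insert a s ha ih =>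
    intro ν _ hν h
    rw [Finset.sum_insert ha] at h ⊢
    set M := ∑ i ∈ s, m i with hM
    have hMi : Integrable (fun x : ℝ => x) M :=
      integrable_finsetSum_measure.2 fun i _ => hm i
    have h' := h
    rw [measureReal_add_apply] at h'
    have ha' : (m a).real univ ≤ ν.real univ := by
      linarith [measureReal_nonneg (μ := M) (s := univ)]
    obtain ⟨S, hSν, hpot, hmass, hmean⟩ := exists_shadow (hm a) hν ha'
    have : IsFiniteMeasure S := isFiniteMeasure_of_le ν hSν
    have hSi : Integrable (fun x : ℝ => x) S := hν.mono_measure hSν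
    have hR : S + (ν - S) = ν := by rw [add_comm]; exact Measure.sub_add_cancel_of_le hSν
    have hRle : ν - S ≤ ν := Measure.sub_le
    have : IsFiniteMeasure (ν - S) := isFiniteMeasure_of_le ν hRle
    have hRi : Integrable (fun x : ℝ => x) (ν - S) := hν.mono_measure hRle
    have hRmass : S.real univ + (ν - S).real univ = ν.real univ := by
      rw [← measureReal_add_apply, hR]
    obtain ⟨θ, hθ, hθm, hcost⟩ := ih (ν - S) hRi (by linarith)
    have hne : ∀ i ∈ s, i ≠ a := fun i hi e => ha (e ▸ hi)
    refine ⟨Function.update θ a S, ?_, fun i hi => ?_, ?_⟩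
    · rw [Finset.sum_insert ha, Function.update_self,
        Finset.sum_congr rfl fun i hi => Function.update_of_ne (hne i hi) S θ]
      calc S + ∑ i ∈ s, θ i ≤ S + (ν - S) := by gcongr
        _ = ν := hR
    · rcases Finset.mem_insert.1 hi with rfl | hi
      · rw [Function.update_self, hmass]
      · rw [Function.update_of_ne (hne i hi), hθm i hi]
    · rw [Finset.sum_insert ha, Function.update_self,
        Finset.sum_congr rfl fun i hi => by rw [Function.update_of_ne (hne i hi) S θ]]
      have hp := putGap_le_sub (hm a) hMi hSi hRi hR h' hpot
      have hc := callGap_le_sub (hm a) hMi hSi hRi hR h' hpot hmass hmean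
      have hp0 := putGap_nonneg (hm a) hν ha'
      have hc0 := callGap_nonneg (hm a) hν ha'
      -- The shift of the mean is `p - c` with `p, c ≥ 0`.
      have : |mean (m a) - mean S| ≤ putGap (m a) ν + callGap (m a) ν := by
        rw [hmean, abs_le]; constructor <;> linarith
      linarith

theorem sum_restrict_fiber (μ : Measure ℝ) (g : SimpleFunc ℝ ℝ) :
    ∑ i ∈ g.range, μ.restrict (g ⁻¹' {i}) = μ := by
  ext t ht
  rw [Measure.finsetSum_apply]
  calc ∑ i ∈ g.range, μ.restrict (g ⁻¹' {i}) t
      = ∑ i ∈ g.range, μ.restrict t (g ⁻¹' {i}) := by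
        refine Finset.sum_congr rfl fun i _ => ?_
        rw [Measure.restrict_apply ht, Measure.restrict_apply (g.measurableSet_fiber i),
          inter_comm]
    _ = μ t := by rw [g.sum_range_measure_preimage_singleton, Measure.restrict_apply_univ]

theorem exists_isProbabilityMeasure_smul {α : Type*} [MeasurableSpace α] [Nonempty α]
    (θ : Measure α) [IsFiniteMeasure θ] :
    ∃ ρ : Measure α, IsProbabilityMeasure ρ ∧ θ = θ univ • ρ := by
  by_cases h : θ = 0
  · inhabit α
    exact ⟨Measure.dirac default, inferInstance, by simp [h]⟩
  · have h0 : θ univ ≠ 0 := fun e => h (Measure.measure_univ_eq_zero.1 e)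
    refine ⟨(θ univ)⁻¹ • θ, ⟨?_⟩, ?_⟩
    · rw [Measure.smul_apply, smul_eq_mul, ENNReal.inv_mul_cancel h0 (measure_ne_top _ _)]
    · rw [smul_smul, ENNReal.mul_inv_cancel h0 (measure_ne_top _ _), one_smul]

/-- The transport cost between measures of equal mass is at most `p + c`. -/
theorem weakCost_le {μ θ : Measure ℝ} [IsFiniteMeasure μ] [IsFiniteMeasure θ]
    (hμ : Integrable (fun x : ℝ => x) μ) (hθ : Integrable (fun x : ℝ => x) θ)
    (h : μ univ = θ univ) : weakCost μ θ ≤ ENNReal.ofReal (putGap μ θ + callGap μ θ) := by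
  have hr : μ.real univ = θ.real univ := by rw [measureReal_def, h, measureReal_def]
  refine ENNReal.le_of_forall_pos_le_add fun ε hε _ => ?_
  have hε2 : ENNReal.ofReal (ε / 2) ≠ 0 := by
    simpa using hε
  -- The pieces of μ are the fibres of a simple function near the identity. The tolerance is `ε / 2`
  -- because this error enters twice.
  obtain ⟨g, hg, -⟩ := (memLp_one_iff_integrable.2 hμ).exists_simpleFunc_eLpNorm_sub_lt
    ENNReal.one_ne_top hε2
  have hgi : Integrable g μ := g.integrable_of_isFiniteMeasure
  have hxg : Integrable (fun x => |x - g x|) μ := (hμ.sub hgi).abs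
  have hgε : ∫ x, |x - g x| ∂μ < ε / 2 := by
    rw [eLpNorm_one_eq_lintegral_enorm, ← ofReal_integral_norm_eq_lintegral_enorm (hμ.sub hgi)]
      at hg
    exact (ENNReal.ofReal_lt_ofReal_iff_of_nonneg (integral_nonneg fun _ => abs_nonneg _)).1 hg
  set A : ℝ → Set ℝ := fun i => g ⁻¹' {i} with hA
  have hAm : ∀ i, MeasurableSet (A i) := fun i => g.measurableSet_fiber i
  have hsum : ∑ i ∈ g.range, μ.restrict (A i) = μ := sum_restrict_fiber μ g
  obtain ⟨τ, hτ, hτm, hcost⟩ := exists_embedding g.range (fun i => μ.restrict (A i))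
    (fun i => hμ.restrict) θ hθ (by rw [hsum, hr])
  rw [hsum] at hcost
  have hτle : ∀ i ∈ g.range, τ i ≤ θ := fun i hi =>
    (Finset.single_le_sum (f := τ) (fun _ _ => Measure.zero_le _) hi).trans hτ
  have hρ : ∀ i, ∃ ρ : Measure ℝ, IsProbabilityMeasure ρ ∧
      (i ∈ g.range → τ i = μ (A i) • ρ) := fun i => by
    by_cases hi : i ∈ g.range
    · have : IsFiniteMeasure (τ i) := isFiniteMeasure_of_le θ (hτle i hi)
      obtain ⟨ρ, hρ1, hρ2⟩ := exists_isProbabilityMeasure_smul (τ i)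
      refine ⟨ρ, hρ1, fun _ => ?_⟩
      have h1 := hτm i hi
      rw [measureReal_def, measureReal_def, ENNReal.toReal_eq_toReal_iff' (measure_ne_top _ _)
        (measure_ne_top _ _), Measure.restrict_apply_univ] at h1
      rwa [h1] at hρ2
    · exact ⟨Measure.dirac 0, inferInstance, fun h => absurd h hi⟩
  choose ρ hρp hρ using hρ
  have hτsum : ∑ i ∈ g.range, τ i = θ := by
    refine eq_of_le_of_univ_le hτ ?_
    rw [← h, ← g.sum_range_measure_preimage_singleton μ, Measure.finsetSum_apply]
    refine Finset.sum_le_sum fun i hi => ?_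
    have := hρp i
    rw [hρ i hi, Measure.smul_apply, measure_univ, smul_eq_mul, mul_one]
  -- Every point of a fibre is sent to the normalized image of that fibre; the kernel is a simple
  -- function, hence measurable.
  set κ : Kernel ℝ ℝ := ⟨fun x => ρ (g x), (g.map ρ).measurable⟩ with hκdef
  have hκ : ∀ x, κ x = ρ (g x) := fun x => rfl
  have : IsMarkovKernel κ := ⟨fun x => hρp (g x)⟩
  have hfst : (μ ⊗ₘ κ).map Prod.fst = μ := Measure.fst_compProd μ κ
  have hsnd : (μ ⊗ₘ κ).map Prod.snd = θ := by
    ext t ht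
    rw [Measure.map_apply measurable_snd ht, Measure.compProd_apply (measurable_snd ht)]
    have e1 : ∀ x, κ x (Prod.mk x ⁻¹' (Prod.snd ⁻¹' t)) = g.map (fun i => ρ i t) x := fun x => rfl
    simp only [e1]
    rw [SimpleFunc.lintegral_eq_lintegral, SimpleFunc.map_lintegral, ← hτsum,
      Measure.finsetSum_apply]
    refine Finset.sum_congr rfl fun i hi => ?_
    rw [hρ i hi, Measure.smul_apply, smul_eq_mul, mul_comm]
  have hi1 : Integrable (fun z : ℝ × ℝ => z.1) (μ ⊗ₘ κ) := by
    rw [← hfst] at hμ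
    exact (integrable_map_measure aestronglyMeasurable_id measurable_fst.aemeasurable).1 hμ
  have hi2 : Integrable (fun z : ℝ × ℝ => z.2) (μ ⊗ₘ κ) := by
    rw [← hsnd] at hθ
    exact (integrable_map_measure aestronglyMeasurable_id measurable_snd.aemeasurable).1 hθ
  have hπ : μ ⊗ₘ κ ∈ couplings μ θ := ⟨⟨inferInstance, hi1.prodMk hi2⟩, hfst, hsnd⟩
  have hb := integrable_barycentre hπ
  have hxb : Integrable (fun x => |x - ∫ y, y ∂κ x|) μ := (hμ.sub hb).abs
  have hreal : ∫ x, |x - ∫ y, y ∂κ x| ∂μ ≤ putGap μ θ + callGap μ θ + ε := by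
    -- Compare `x` with the fibre value `i`, then `i` with the barycentre; replacing `μ.real (A i) *
    -- i` by the mean of the piece costs the error `|x - i|` a second time.
    have hpiece : ∀ i ∈ g.range, ∫ x in A i, |x - ∫ y, y ∂κ x| ∂μ ≤
        2 * (∫ x in A i, |x - g x| ∂μ) + |mean (μ.restrict (A i)) - mean (τ i)| := by
      intro i hi
      have hmean : mean (τ i) = μ.real (A i) * mean (ρ i) := by
        rw [hρ i hi, mean, integral_smul_measure, smul_eq_mul]; rfl
      have hxi : IntegrableOn (fun x => |x - i|) (A i) μ :=
        (hμ.sub (integrable_const i)).abs.integrableOn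
      have e1 : ∫ x in A i, |x - g x| ∂μ = ∫ x in A i, |x - i| ∂μ :=
        setIntegral_congr_fun (hAm i) fun x hx => by
          have : g x = i := hx
          simp only [this]
      have e2 : ∫ x in A i, |x - ∫ y, y ∂κ x| ∂μ = ∫ x in A i, |x - mean (ρ i)| ∂μ :=
        setIntegral_congr_fun (hAm i) fun x hx => by
          have : g x = i := hx
          simp only [hκ, this, mean]
      have e3 : mean (μ.restrict (A i)) - μ.real (A i) * i = ∫ x in A i, (x - i) ∂μ := by
        rw [integral_sub hμ.integrableOn (integrable_const i), mean]
        simp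
      have l1 : |mean (μ.restrict (A i)) - μ.real (A i) * i| ≤ ∫ x in A i, |x - i| ∂μ := by
        rw [e3]; exact abs_integral_le_integral_abs
      have l2 : ∫ x in A i, |x - mean (ρ i)| ∂μ ≤
          (∫ x in A i, |x - i| ∂μ) + μ.real (A i) * |i - mean (ρ i)| := by
        have : ∫ x in A i, |x - mean (ρ i)| ∂μ ≤ ∫ x in A i, (|x - i| + |i - mean (ρ i)|) ∂μ :=
          integral_mono (hμ.sub (integrable_const _)).abs.integrableOn
            (hxi.add (integrable_const _)) fun x => abs_sub_le _ _ _
        rw [integral_add hxi (integrable_const _)] at this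
        simpa using this
      have l3 : μ.real (A i) * |i - mean (ρ i)| ≤
          |mean (μ.restrict (A i)) - μ.real (A i) * i| +
            |mean (μ.restrict (A i)) - mean (τ i)| := by
        rw [← abs_of_nonneg (measureReal_nonneg (μ := μ) (s := A i)), ← abs_mul,
          abs_of_nonneg (measureReal_nonneg (μ := μ) (s := A i)), mul_sub, ← hmean,
          abs_sub_comm (mean (μ.restrict (A i))) (μ.real (A i) * i)]
        exact abs_sub_le _ _ _
      rw [e1, e2]
      linarith
    have key : ∀ f : ℝ → ℝ, Integrable f μ → ∫ x, f x ∂μ = ∑ i ∈ g.range, ∫ x in A i, f x ∂μ :=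
      fun f hf => by
        conv_lhs => rw [← hsum]
        exact integral_finsetSum_measure fun i _ => hf.restrict
    calc ∫ x, |x - ∫ y, y ∂κ x| ∂μ = ∑ i ∈ g.range, ∫ x in A i, |x - ∫ y, y ∂κ x| ∂μ :=
          key _ hxb
      _ ≤ ∑ i ∈ g.range, (2 * (∫ x in A i, |x - g x| ∂μ) +
            |mean (μ.restrict (A i)) - mean (τ i)|) := Finset.sum_le_sum hpiece
      _ = 2 * (∫ x, |x - g x| ∂μ) +
            ∑ i ∈ g.range, |mean (μ.restrict (A i)) - mean (τ i)| := by
          rw [Finset.sum_add_distrib, ← Finset.mul_sum, key _ hxg]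
      _ ≤ _ := by linarith
  calc weakCost μ θ ≤ ∫⁻ x, ENNReal.ofReal |x - ∫ y, y ∂κ x| ∂μ :=
        (iInf₂_le (μ ⊗ₘ κ) hπ).trans
          ((iInf₂_le κ ‹IsMarkovKernel κ›).trans (iInf_le _ rfl))
    _ = ENNReal.ofReal (∫ x, |x - ∫ y, y ∂κ x| ∂μ) :=
        (ofReal_integral_eq_lintegral_ofReal hxb (Eventually.of_forall fun _ => abs_nonneg _)).symm
    _ ≤ ENNReal.ofReal (putGap μ θ + callGap μ θ + ε) := ENNReal.ofReal_le_ofReal hreal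
    _ ≤ _ := ENNReal.ofReal_add_le.trans (by rw [ENNReal.ofReal_coe_nnreal])

/-! ### The shadow as a minimizer -/

theorem putPot_mono_measure {θ ν : Measure ℝ} [IsFiniteMeasure ν]
    (hν : Integrable (fun x : ℝ => x) ν) (h : θ ≤ ν) (k : ℝ) : putPot θ k ≤ putPot ν k :=
  integral_mono_measure h (Eventually.of_forall fun _ => le_max_right _ _) (integrable_put hν k)

theorem callPot_mono_measure {θ ν : Measure ℝ} [IsFiniteMeasure ν]
    (hν : Integrable (fun x : ℝ => x) ν) (h : θ ≤ ν) (k : ℝ) : callPot θ k ≤ callPot ν k :=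
  integral_mono_measure h (Eventually.of_forall fun _ => le_max_right _ _) (integrable_call hν k)

theorem measureReal_univ_eq {μ θ : Measure ℝ} (h : θ univ = μ univ) :
    θ.real univ = μ.real univ := by
  rw [measureReal_def, h, measureReal_def]

/-- The transport cost to any target is at least `p + c`. -/
theorem le_weakCost {μ ν θ : Measure ℝ} [IsFiniteMeasure μ] [IsFiniteMeasure ν]
    (hμ : Integrable (fun x : ℝ => x) μ) (hν : Integrable (fun x : ℝ => x) ν)
    (hθ : θ ∈ targets μ ν) :
    ENNReal.ofReal (putGap μ ν + callGap μ ν) ≤ weakCost μ θ := by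
  by_contra hlt
  push Not at hlt
  have := hθ.1.1
  obtain ⟨A, B, hAB, -, hA, hB⟩ := exists_bounds_of_weakCost_lt hμ hθ.1.2 hlt
  have h1 : putGap μ ν ≤ A := ciSup_le fun k => by
    linarith [hA k, putPot_mono_measure hν hθ.2.2 k]
  have h2 : callGap μ ν ≤ B := ciSup_le fun k => by
    linarith [hB k, callPot_mono_measure hν hθ.2.2 k]
  linarith

theorem putGap_nonpos {η χ : Measure ℝ} (h : ∀ k, putPot η k ≤ putPot χ k) : putGap η χ ≤ 0 :=
  ciSup_le fun k => sub_nonpos.2 (h k)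

/-- With equal mass and mean, parity orders the calls too. Both gaps are then nonpositive, so the
transport cost vanishes. -/
theorem convexLE_of_putPot_le {η χ : Measure ℝ} [IsFiniteMeasure η] [IsFiniteMeasure χ]
    (hη : Integrable (fun x : ℝ => x) η) (hχ : Integrable (fun x : ℝ => x) χ)
    (hu : η univ = χ univ) (hm : mean η = mean χ) (h : ∀ k, putPot η k ≤ putPot χ k) :
    ConvexLE η χ := by
  have hc : callGap η χ ≤ 0 := ciSup_le fun k => by
    rw [callPot_eq hη, callPot_eq hχ, measureReal_univ_eq hu, hm]
    linarith [h k]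
  refine convexLE_of_weakCost_eq_zero hη hχ (nonpos_iff_eq_zero.1 ?_)
  refine (weakCost_le hη hχ hu).trans ?_
  rw [ENNReal.ofReal_of_nonpos (by linarith [putGap_nonpos h])]

theorem ConvexLE.putPot_le {η χ : Measure ℝ} [IsFiniteMeasure χ]
    (hχ : Integrable (fun x : ℝ => x) χ) (h : ConvexLE η χ) (k : ℝ) : putPot η k ≤ putPot χ k :=
  (h _ (convexOn_put' k) (integrable_put hχ k)).2

section shadow

variable {μ ν S : Measure ℝ} [IsFiniteMeasure μ] [IsFiniteMeasure ν]

theorem putPot_sub_le_of_shadow (hμ : Integrable (fun x : ℝ => x) μ)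
    (hν : Integrable (fun x : ℝ => x) ν) (h : μ.real univ ≤ ν.real univ)
    (hpot : ∀ k, putPot S k = shadowFun μ ν k - putGap μ ν) (k : ℝ) :
    putPot μ k - putPot S k ≤ putGap μ ν := by
  have h1 := (hasConvMinorant_putPot_sub hμ hν h).convMinorant_le k
  have h2 := hpot k
  unfold shadowFun at h2
  linarith

theorem weakCost_shadow_le (hμ : Integrable (fun x : ℝ => x) μ)
    (hν : Integrable (fun x : ℝ => x) ν) (h : μ.real univ ≤ ν.real univ) (hS : S ∈ targets μ ν)
    (hpot : ∀ k, putPot S k = shadowFun μ ν k - putGap μ ν)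
    (hmean : mean S = mean μ + putGap μ ν - callGap μ ν) :
    weakCost μ S ≤ ENNReal.ofReal (putGap μ ν + callGap μ ν) := by
  have := hS.1.1
  refine (weakCost_le hμ hS.1.2 hS.2.1.symm).trans (ENNReal.ofReal_le_ofReal (add_le_add ?_ ?_))
  · exact ciSup_le fun k => putPot_sub_le_of_shadow hμ hν h hpot k
  · refine ciSup_le fun k => ?_
    rw [callPot_eq hμ, callPot_eq hS.1.2, measureReal_univ_eq hS.2.1]
    linarith [putPot_sub_le_of_shadow hμ hν h hpot k]

theorem shadow_convexLE (hμ : Integrable (fun x : ℝ => x) μ)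
    (hν : Integrable (fun x : ℝ => x) ν) (hS : S ∈ targets μ ν)
    (hpot : ∀ k, putPot S k = shadowFun μ ν k - putGap μ ν)
    (hmean : mean S = mean μ + putGap μ ν - callGap μ ν) {θ : Measure ℝ} (hθ : θ ∈ targets μ ν)
    (hcost : weakCost μ θ ≤ ENNReal.ofReal (putGap μ ν + callGap μ ν))
    (h0 : 0 ≤ putGap μ ν + callGap μ ν) : ConvexLE S θ := by
  have := hS.1.1
  have := hθ.1.1
  -- The infimum in the cost is not known to be attained. Near-optimal couplings have `A`, `B`
  -- within `ε` of `p`, `c`, which suffices for the limit.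
  have hbound : ∀ ε > 0, ∃ A B : ℝ, A + B < putGap μ ν + callGap μ ν + ε ∧
      A - B = mean θ - mean μ ∧ (∀ k, putPot μ k - putPot θ k ≤ A) ∧
      putGap μ ν ≤ A ∧ callGap μ ν ≤ B := fun ε hε => by
    obtain ⟨A, B, hAB, hm, hA, hB⟩ := exists_bounds_of_weakCost_lt hμ hθ.1.2
      (hcost.trans_lt ((ENNReal.ofReal_lt_ofReal_iff (by linarith)).2
        (lt_add_of_pos_right _ hε)))
    exact ⟨A, B, hAB, hm, hA,
      ciSup_le fun k => by linarith [hA k, putPot_mono_measure hν hθ.2.2 k],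
      ciSup_le fun k => by linarith [hB k, callPot_mono_measure hν hθ.2.2 k]⟩
  have hput : ∀ k, putPot μ k - putGap μ ν ≤ putPot θ k := fun k => by
    refine le_of_forall_pos_le_add fun ε hε => ?_
    obtain ⟨A, B, hAB, -, hA, -, hB⟩ := hbound ε hε
    linarith [hA k]
  have hmθ : mean S = mean θ := by
    rw [hmean]
    refine le_antisymm (le_of_forall_pos_le_add fun ε hε => ?_)
      (le_of_forall_pos_le_add fun ε hε => ?_) <;>
    · obtain ⟨A, B, hAB, hm, -, hA, hB⟩ := hbound ε hε
      linarith
  have hR : θ + (ν - θ) = ν := by rw [add_comm]; exact Measure.sub_add_cancel_of_le hθ.2.2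
  have hRle : ν - θ ≤ ν := Measure.sub_le
  have : IsFiniteMeasure (ν - θ) := isFiniteMeasure_of_le ν hRle
  have hRi : Integrable (fun x : ℝ => x) (ν - θ) := hν.mono_measure hRle
  refine convexLE_of_putPot_le hS.1.2 hθ.1.2 (hS.2.1.trans hθ.2.1.symm) hmθ fun k => ?_
  have hsum : ∀ x, putPot ν x = putPot θ x + putPot (ν - θ) x := fun x => by
    rw [← putPot_add hθ.1.2 hRi, hR]
  -- `P_μ - p ≤ P_θ` says exactly that `P_{ν-θ} - p` is a minorant of `P_ν - P_μ`; maximality of `D`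
  -- yields `P_S ≤ P_θ`.
  have h1 := le_convMinorant (f := fun x => putPot ν x - putPot μ x)
    (g := fun x => putPot (ν - θ) x + (0 * x + -putGap μ ν))
    ((convexOn_putPot hRi).add (convexOn_affine _ _)) (fun x => by
      linarith [hsum x, hput x]) k
  have h2 := hpot k
  unfold shadowFun at h2
  linarith [hsum k]

end shadow

end ShadowWOT

/-! ### The shadow as the least minimizer -/

open ShadowWOT
theorem mainTheorem5 (μ ν : Measure ℝ) (hμ : μ ∈ FinMoment ℝ) (hν : ν ∈ FinMoment ℝ)
    (hmass : μ Set.univ ≤ ν Set.univ) :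
    -- the shadow measure exists, and it is the only measure with the defining property
    (shadow μ ν ∈ targets μ ν ∧
      IsSecondDistribDeriv (shadowFun μ ν) (shadow μ ν) ∧
      (∀ k, putPot (shadow μ ν) k = shadowFun μ ν k - putGap μ ν) ∧
      mean (shadow μ ν) = mean μ + putGap μ ν - callGap μ ν ∧
      (∀ S ∈ targets μ ν, (∀ k, putPot S k = shadowFun μ ν k - putGap μ ν) → S = shadow μ ν)) ∧
    -- it minimizes the weak transport cost
    shadow μ ν ∈ minimizers μ ν ∧
    -- it is below every minimizer in convex order
    (∀ θ ∈ minimizers μ ν, ConvexLE (shadow μ ν) θ) ∧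
    -- it is the only target with these two properties
    (∀ S ∈ targets μ ν, S ∈ minimizers μ ν → (∀ θ ∈ minimizers μ ν, ConvexLE S θ) →
      S = shadow μ ν) := by
  obtain ⟨hμf, hμi⟩ := hμ
  obtain ⟨hνf, hνi⟩ := hν
  have h : μ.real Set.univ ≤ ν.real Set.univ :=
    ENNReal.toReal_mono (measure_ne_top _ _) hmass
  obtain ⟨S, hSν, hpot, hSmass, hmean⟩ := exists_shadow hμi hνi h
  have hSf : IsFiniteMeasure S := isFiniteMeasure_of_le ν hSν
  have hSi : Integrable (fun x : ℝ => x) S := hνi.mono_measure hSν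
  have hST : S ∈ targets μ ν := ⟨⟨hSf, hSi⟩,
    (ENNReal.toReal_eq_toReal_iff' (measure_ne_top _ _) (measure_ne_top _ _)).1 hSmass, hSν⟩
  have huniq : ∀ T ∈ targets μ ν, (∀ k, putPot T k = shadowFun μ ν k - putGap μ ν) → T = S :=
    fun T hT hTp => by
      have := hT.1.1
      exact eq_of_putPot_eq hT.1.2 hSi fun k => by rw [hTp, hpot]
  have hex : ∃ S ∈ targets μ ν, ∀ k, putPot S k = shadowFun μ ν k - putGap μ ν :=
    ⟨S, hST, hpot⟩
  have hshadow : shadow μ ν = S := by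
    unfold shadow
    rw [dif_pos hex]
    -- Uniqueness identifies the measure picked by choice with the constructed one.
    exact huniq _ hex.choose_spec.1 hex.choose_spec.2
  rw [hshadow]
  have h0 : 0 ≤ putGap μ ν + callGap μ ν :=
    add_nonneg (putGap_nonneg hμi hνi h) (callGap_nonneg hμi hνi h)
  have hScost := weakCost_shadow_le hμi hνi h hST hpot hmean
  have hSmin : S ∈ minimizers μ ν :=
    ⟨hST, fun θ hθ => hScost.trans (le_weakCost hμi hνi hθ)⟩
  have hSle : ∀ θ ∈ minimizers μ ν, ConvexLE S θ := fun θ hθ =>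
    shadow_convexLE hμi hνi hST hpot hmean hθ.1 ((hθ.2 S hST).trans hScost) h0
  refine ⟨⟨hST, ?_, hpot, hmean, huniq⟩, hSmin, hSle, fun T hT hTmin hTle => ?_⟩
  · have e : shadowFun μ ν = fun k => putPot S k + putGap μ ν := by
      funext k
      rw [hpot]; ring
    rw [e]
    exact isSecondDistribDeriv_putPot_add hSi _
  · have := hT.1.1
    exact eq_of_putPot_eq hT.1.2 hSi fun k =>
      -- `S` and `T` are both minimizers, so each is below the other in convex order and their puts
      -- agree.
      le_antisymm ((hTle S hSmin).putPot_le hSi k) ((hSle T hTmin).putPot_le hT.1.2 k)
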